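/- Let $(X,d,\mu)$ be a space of homogeneous type: $d$ is a quasi-metric on $X$ with $d(x,y)\le A_0(d(x,z)+d(z,y))$, $A_0\ge 1$; $X$ carries the topology in which $U$ is open iff every $x\in U$ has a ball $B(x,r)=\{y: d(x,y)<r\}\subset U$; all balls are Borel sets; and $\mu$ is a Borel measure with $0<\mu(B(x,2r))\le A_1\mu(B(x,r))<\infty$ for all $x\in X$, $r>0$. Assume $\mu(X)=\infty$ and $\mu(\{x\})=0$ for every $x\in X$. Let $C_\mu$ be the smallest admissible $A_1$ and $\mathbb Q=\log_2 C_\mu$. Let $\omega\colon[0,1]\to[0,\infty)$ be continuous, increasing and subadditive with $\omega(0)=0$ and $\int_0^1\omega(t)\,\frac{dt}{t}<\infty$. Let $K$ be an $\omega$-Calderón–Zygmund kernel: with $V(x,y)=\mu(B(x,d(x,y)))$, $|K(x,y)|\le c_K/V(x,y)$ for $x\ne y$, and $$|K(x,y)-K(x',y)|+|K(y,x)-K(y,x')|\le \frac{1}{V(x,y)}\,\omega\Big(\frac{d(x,x')}{d(x,y)}\Big)\quad\text{if } d(x,x')<(2A_0)^{-1}d(x,y).$$ Suppose $K$ is non-degenerate: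 there are $c_0,\bar C>0$ such that for all $x\in X$, $r>0$ there is $y\in B(x,\bar Cr)\setminus B(x,r)$ with $|K(x,y)|\ge \frac{1}{c_0\mu(B(x,r))}$. Let $T$ be a bounded linear operator on $L^2(X)$ such that, for every $f\in L^2(X)$, $Tf(x)=\int_X K(x,y)f(y)\,d\mu(y)$ for almost every $x\notin\operatorname{supp} f$; denote also by $T$ its bounded continuation $L^1(X)\to L^{1,\infty}(X)$. Let $1<p\le q<\infty$ and $\frac{\alpha}{\mathbb Q}=\frac1p-\frac1q$. Write $\|f\|_{L^p_w}=(\int_X|fw|^p\,d\mu)^{1/p}$, $w(B)=\int_B w\,d\mu$, $$[w]_{A_p}=\sup_B\frac{\big(\int_B w\,d\mu\big)\big(\int_B w^{-1/(p-1)}\,d\mu\big)^{p-1}}{\mu(B)^p},\qquad [w]_{A_{p,p}}=[w^p]_{A_p}^{1/p},$$ and $w\in A_{p,p}$ if $w\colon X\to(0,\infty)$ and $w^p$ are integrable on balls and $[w]_{A_{p,p}}<\infty$. Let $\lambda_1\in A_{p,p}$, $\lambda_2\in A_{q,q}$, and $\nu=(\lambda_1/\lambda_2)^{1/(1/p+1/q')}$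 with $\frac1q+\frac1{q'}=1$. Let $b\colon X\to\mathbb C$ be measurable and integrable on every ball, and let $[b,T]f=bTf-T(bf)$ for $f$ in the space $L^\infty_{\rm bs}(X)$ of bounded measurable functions with bounded support. If $[b,T]$ is bounded from $L^p_{\lambda_1}(X)$ to $L^q_{\lambda_2}(X)$, that is, if $\|[b,T]f\|_{L^q_{\lambda_2}}\le\Theta\|f\|_{L^p_{\lambda_1}}$ for some $\Theta<\infty$ and all $f\in L^\infty_{\rm bs}(X)$, with $\|[b,T]\|$ the infimum of such $\Theta$, then $b\in \mathrm{BMO}^\alpha_\nu(X)$ and $$\|b\|_{\mathrm{BMO}^\alpha_\nu(X)}:=\sup_B\frac{1}{\nu(B)^{\alpha/\mathbb Q}}\bigg(\frac{1}{\nu(B)}\int_B|b-\langle b\rangle_B|\,d\mu\bigg)\le C\,\|[b,T]\|,\qquad \langle b\rangle_B=\frac1{\mu(B)}\int_B b\,d\mu,$$ where the suprema are over all balls and the constant $C>0$ depends only on $A_0$, $A_1$, $c_K$, $\omega$, $c_0$, $\bar C$, $p$, $q$ and on upper bounds for $[\lambda_1]_{A_{p,p}}$ and $[\lambda_2]_{A_{q,q}}$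 (in particular not on $b$). -/

import Mathlib

open MeasureTheory Filter Topology
open scoped NNReal ENNReal

namespace FracBloom

noncomputable section

variable {X : Type*}

/-! ### Spaces of homogeneous type -/

/-- The ball `B(x, r) = {y : d x y < r}` of a quasi-metric `d`. -/
def qball (d : X → X → ℝ) (x : X) (r : ℝ) : Set X := {y | d x y < r}

/-- `(X, d, μ)` is a space of homogeneous type with quasi-triangle constant `A₀` and doubling
constant `A₁`, with `μ(X) = ∞` and without atoms. The topology of `X` is the one induced by `d`,
and `μ` is a measure on its Borel sets, which include all balls. -/
structure IsHomogeneousType [TopologicalSpace X] [MeasurableSpace X] [BorelSpace X]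
    (d : X → X → ℝ) (μ : Measure X) (A₀ A₁ : ℝ) : Prop where
  dist_symm : ∀ x y, d x y = d y x
  dist_nonneg : ∀ x y, 0 ≤ d x y
  dist_eq_zero : ∀ x y, d x y = 0 ↔ x = y
  one_le_quasi : 1 ≤ A₀
  quasi_triangle : ∀ x y z, d x y ≤ A₀ * (d x z + d z y)
  isOpen_iff : ∀ U : Set X, IsOpen U ↔ ∀ x ∈ U, ∃ r > 0, qball d x r ⊆ U
  measurableSet_ball : ∀ x r, MeasurableSet (qball d x r)
  one_le_doubling : 1 ≤ A₁
  ball_pos : ∀ x, ∀ r > 0, 0 < μ (qball d x (2 * r))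
  doubling : ∀ x, ∀ r > 0, μ (qball d x (2 * r)) ≤ ENNReal.ofReal A₁ * μ (qball d x r)
  ball_lt_top : ∀ x, ∀ r > 0, μ (qball d x r) < ∞
  measure_univ : μ Set.univ = ∞
  measure_singleton : ∀ x, μ {x} = 0

/-- The smallest doubling constant `C_μ` of `μ`. -/
def doublingConst [MeasurableSpace X] (d : X → X → ℝ) (μ : Measure X) : ℝ :=
  sInf {A : ℝ | 1 ≤ A ∧ ∀ x, ∀ r > 0, μ (qball d x (2 * r)) ≤ ENNReal.ofReal A * μ (qball d x r)}

/-- The upper dimension `ℚ = log₂ C_μ` of `μ`. -/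
def upperDim [MeasurableSpace X] (d : X → X → ℝ) (μ : Measure X) : ℝ :=
  Real.logb 2 (doublingConst d μ)

/-! ### Function classes -/

/-- `b ∈ L¹_loc(X)`: measurable and integrable on every ball. -/
def MemL1loc [MeasurableSpace X] (d : X → X → ℝ) (μ : Measure X) (b : X → ℂ) : Prop :=
  Measurable b ∧ ∀ x, ∀ r > 0, IntegrableOn b (qball d x r) μ

/-- `f ∈ L^∞_bs(X)`: measurable, bounded, and with bounded support. -/
def MemLinftyBs [TopologicalSpace X] [MeasurableSpace X] (d : X → X → ℝ) (f : X → ℂ) : Prop :=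
  Measurable f ∧ (∃ M : ℝ, ∀ x, ‖f x‖ ≤ M) ∧ ∃ x, ∃ r > 0, tsupport f ⊆ qball d x r

/-- The weighted norm `‖f‖_{L^p_w} = (∫ |f w|^p dμ)^{1/p}`. -/
def wnorm [MeasurableSpace X] (μ : Measure X) (p : ℝ) (w : X → ℝ) (f : X → ℂ) : ℝ≥0∞ :=
  eLpNorm (fun x => f x * (w x : ℂ)) (ENNReal.ofReal p) μ

/-! ### Weights -/

/-- `w(E) = ∫_E w dμ`. -/
def wmeas [MeasurableSpace X] (μ : Measure X) (w : X → ℝ) (E : Set X) : ℝ≥0∞ :=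
  ∫⁻ x in E, ENNReal.ofReal (w x) ∂μ

/-- A weight: a locally integrable function `w : X → (0, ∞)`. -/
def IsWeight [MeasurableSpace X] (d : X → X → ℝ) (μ : Measure X) (w : X → ℝ) : Prop :=
  Measurable w ∧ (∀ x, 0 < w x) ∧ ∀ x, ∀ r > 0, IntegrableOn w (qball d x r) μ

/-- The Muckenhoupt characteristic
`[w]_{A_p} = sup_B w(B) (∫_B w^{-1/(p-1)} dμ)^{p-1} / μ(B)^p`. -/
def apConst [MeasurableSpace X] (d : X → X → ℝ) (μ : Measure X) (p : ℝ) (w : X → ℝ) : ℝ≥0∞ :=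
  ⨆ (x : X) (r : ℝ) (_ : 0 < r),
    wmeas μ w (qball d x r) *
      (wmeas μ (fun y => w y ^ (-(1 / (p - 1)))) (qball d x r)) ^ (p - 1) /
        μ (qball d x r) ^ p

/-- `w ∈ A_p`. -/
def IsAp [MeasurableSpace X] (d : X → X → ℝ) (μ : Measure X) (p : ℝ) (w : X → ℝ) : Prop :=
  IsWeight d μ w ∧ apConst d μ p w < ∞

/-- `w ∈ A_{p,p}`, that is, `w^p ∈ A_p`. -/
def IsApp [MeasurableSpace X] (d : X → X → ℝ) (μ : Measure X) (p : ℝ) (w : X → ℝ) : Prop :=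
  IsWeight d μ w ∧ IsAp d μ p (fun x => w x ^ p)

/-- `[w]_{A_{p,p}} = [w^p]_{A_p}^{1/p}`. -/
def appConst [MeasurableSpace X] (d : X → X → ℝ) (μ : Measure X) (p : ℝ) (w : X → ℝ) : ℝ≥0∞ :=
  apConst d μ p (fun x => w x ^ p) ^ (1 / p)

/-- The fractional Bloom weight `ν = (w₁ / w₂)^{1 / (1/p + 1/q')}`. -/
def bloomWeight (p q : ℝ) (w₁ w₂ : X → ℝ) : X → ℝ :=
  fun x => (w₁ x / w₂ x) ^ (1 / (1 / p + 1 / q.conjExponent))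

/-! ### Weighted fractional BMO -/

/-- `‖b‖_{BMO_w^α} = sup_B w(B)^{-α/ℚ} w(B)^{-1} ∫_B |b - ⟨b⟩_B| dμ`. -/
def bmoNorm [MeasurableSpace X] (d : X → X → ℝ) (μ : Measure X) (α : ℝ) (w : X → ℝ)
    (b : X → ℂ) : ℝ≥0∞ :=
  ⨆ (x : X) (r : ℝ) (_ : 0 < r),
    ((wmeas μ w (qball d x r)) ^ (α / upperDim d μ))⁻¹ *
      ((wmeas μ w (qball d x r))⁻¹ *
        ∫⁻ y in qball d x r, ‖b y - ⨍ z in qball d x r, b z ∂μ‖ₑ ∂μ)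

/-- `b ∈ BMO_w^α(X)`. -/
def MemBMO [MeasurableSpace X] (d : X → X → ℝ) (μ : Measure X) (α : ℝ) (w : X → ℝ)
    (b : X → ℂ) : Prop :=
  MemL1loc d μ b ∧ bmoNorm d μ α w b < ∞

/-! ### Calderón–Zygmund kernels and operators -/

/-- `ω : [0,1] → [0,∞)` is continuous, increasing and subadditive, with `ω(0) = 0`. -/
structure IsModulus (ω : ℝ → ℝ) : Prop where
  nonneg : ∀ t ∈ Set.Icc (0 : ℝ) 1, 0 ≤ ω t
  continuousOn : ContinuousOn ω (Set.Icc 0 1)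
  monotoneOn : MonotoneOn ω (Set.Icc 0 1)
  subadditive : ∀ s t, 0 ≤ s → 0 ≤ t → s + t ≤ 1 → ω (s + t) ≤ ω s + ω t
  zero : ω 0 = 0

/-- The Dini condition `∫₀¹ ω(t) dt / t < ∞`. -/
def IsDini (ω : ℝ → ℝ) : Prop :=
  ∫⁻ t in Set.Ioc (0 : ℝ) 1, ENNReal.ofReal (ω t / t) < ∞

/-- `V(x, y) = μ(B(x, d(x, y)))`. -/
def vol [MeasurableSpace X] (d : X → X → ℝ) (μ : Measure X) (x y : X) : ℝ :=
  μ.real (qball d x (d x y))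

/-- `K` is an `ω`-Calderón–Zygmund kernel with size constant `cK`. The values of `K` on the
diagonal play no role. -/
structure IsCZKernel [MeasurableSpace X] (d : X → X → ℝ) (μ : Measure X) (A₀ cK : ℝ)
    (ω : ℝ → ℝ) (K : X → X → ℂ) : Prop where
  size : ∀ x y, x ≠ y → ‖K x y‖ ≤ cK / vol d μ x y
  regularity : ∀ x x' y, d x x' < (2 * A₀)⁻¹ * d x y →
    ‖K x y - K x' y‖ + ‖K y x - K y x'‖ ≤ 1 / vol d μ x y * ω (d x x' / d x y)

/-- Non-degeneracy of `K` with constants `c₀` and `Cbar`. -/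
def IsNondegenerate [MeasurableSpace X] (d : X → X → ℝ) (μ : Measure X) (c₀ Cbar : ℝ)
    (K : X → X → ℂ) : Prop :=
  0 < c₀ ∧ 0 < Cbar ∧ ∀ x, ∀ r > 0, ∃ y ∈ qball d x (Cbar * r) \ qball d x r,
    1 / (c₀ * μ.real (qball d x r)) ≤ ‖K x y‖

/-- The value `T f` of an operator `T` on `L²` at a function `f` (`0` if `f ∉ L²`). -/
def applyL2 [MeasurableSpace X] {μ : Measure X} (T : Lp ℂ 2 μ →L[ℂ] Lp ℂ 2 μ) (f : X → ℂ) :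
    X → ℂ :=
  open Classical in if h : MemLp f 2 μ then (T (h.toLp f) : X → ℂ) else 0

/-- The bounded operator `T` on `L²` has the kernel `K`: for every `f ∈ L²`,
`T f (x) = ∫ K(x, y) f(y) dμ(y)` for (almost) every `x ∉ supp f`. -/
def HasKernel [TopologicalSpace X] [MeasurableSpace X] {μ : Measure X}
    (T : Lp ℂ 2 μ →L[ℂ] Lp ℂ 2 μ) (K : X → X → ℂ) : Prop :=
  ∀ f : X → ℂ, Measurable f → MemLp f 2 μ →
    ∀ᵐ x ∂μ, x ∉ tsupport f → applyL2 T f x = ∫ y, K x y * f y ∂μ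

/-! ### The continuation of `T` to `L¹` and the commutator -/

/-- The truncation `h · 1_{|h| ≤ n}`. -/
def trunc (h : X → ℂ) (n : ℕ) : X → ℂ :=
  open Classical in fun x => if ‖h x‖ ≤ n then h x else 0

/-- The first level `n` at which the truncation is within `4^{-k}` of `h` in `L¹`. -/
def truncLevel [MeasurableSpace X] (μ : Measure X) (h : X → ℂ) (k : ℕ) : ℕ :=
  sInf {n : ℕ | eLpNorm (h - trunc h n) 1 μ ≤ (4 : ℝ≥0∞)⁻¹ ^ k}

/-- The continuation of `T` from `L¹ ∩ L²` to `L¹`: the almost everywhere limit of `T h_k`, where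
the truncations `h_k ∈ L¹ ∩ L²` of `h ∈ L¹` satisfy `‖h - h_k‖₁ ≤ 4^{-k}`. By
`IsWeakExtension.ae_eq_applyL1` below, this is the bounded continuation `L¹ → L^{1,∞}`. -/
def applyL1 [MeasurableSpace X] {μ : Measure X} (T : Lp ℂ 2 μ →L[ℂ] Lp ℂ 2 μ) (h : X → ℂ) :
    X → ℂ :=
  fun x => limUnder atTop (fun k : ℕ => applyL2 T (trunc h (truncLevel μ h k)) x)

/-- The commutator `[b, T] f = b T f - T (b f)`, for `f ∈ L^∞_bs` and `b ∈ L¹_loc`. -/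
def commutator [MeasurableSpace X] {μ : Measure X} (b : X → ℂ)
    (T : Lp ℂ 2 μ →L[ℂ] Lp ℂ 2 μ) (f : X → ℂ) : X → ℂ :=
  fun x => b x * applyL2 T f x - applyL1 T (fun y => b y * f y) x

/-- `‖[b, T] f‖_{L^q_{w₂}} ≤ Θ ‖f‖_{L^p_{w₁}}` for all `f` in the dense subspace `L^∞_bs`. -/
def CommutatorBound [TopologicalSpace X] [MeasurableSpace X] (d : X → X → ℝ) {μ : Measure X}
    (p q : ℝ) (w₁ w₂ : X → ℝ) (b : X → ℂ) (T : Lp ℂ 2 μ →L[ℂ] Lp ℂ 2 μ) (Θ : ℝ≥0) : Prop :=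
  ∀ f : X → ℂ, MemLinftyBs d f → wnorm μ q w₂ (commutator b T f) ≤ Θ * wnorm μ p w₁ f

/-- The operator norm `‖[b, T]‖_{L^p_{w₁} → L^q_{w₂}}` (`∞` if `[b, T]` is unbounded). -/
def commutatorNorm [TopologicalSpace X] [MeasurableSpace X] (d : X → X → ℝ) {μ : Measure X}
    (p q : ℝ) (w₁ w₂ : X → ℝ) (b : X → ℂ) (T : Lp ℂ 2 μ →L[ℂ] Lp ℂ 2 μ) : ℝ≥0∞ :=
  ⨅ (Θ : ℝ≥0) (_ : CommutatorBound d p q w₁ w₂ b T Θ), (Θ : ℝ≥0∞)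

/-- A bounded linear continuation `S : L¹ → L^{1,∞}` of `T`. -/
structure IsWeakExtension [MeasurableSpace X] {μ : Measure X} (T : Lp ℂ 2 μ →L[ℂ] Lp ℂ 2 μ)
    (S : Lp ℂ 1 μ →ₗ[ℂ] (X →ₘ[μ] ℂ)) : Prop where
  weak_type : ∃ C : ℝ≥0, ∀ (h : Lp ℂ 1 μ) (t : ℝ≥0), 0 < t →
    t * μ {x | (t : ℝ≥0∞) < ‖S h x‖ₑ} ≤ C * ‖h‖ₑ
  agree : ∀ (f : X → ℂ) (h₁ : MemLp f 1 μ), MemLp f 2 μ → S (h₁.toLp f) =ᵐ[μ] applyL2 T f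

theorem measurable_trunc [MeasurableSpace X] {h : X → ℂ} (hh : Measurable h) (n : ℕ) :
    Measurable (trunc h n) := by
  classical
  unfold trunc
  exact Measurable.ite (measurableSet_le hh.norm measurable_const) hh measurable_const

theorem norm_trunc_le (h : X → ℂ) (n : ℕ) (x : X) : ‖trunc h n x‖ ≤ ‖h x‖ := by
  unfold trunc
  split_ifs <;> simp

theorem memLp_trunc [MeasurableSpace X] {μ : Measure X} {h : X → ℂ} (hh : Measurable h)
    (h1 : MemLp h 1 μ) (n : ℕ) : MemLp (trunc h n) 1 μ ∧ MemLp (trunc h n) 2 μ := by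
  have h1' : MemLp (trunc h n) 1 μ :=
    h1.mono (measurable_trunc hh n).aestronglyMeasurable (.of_forall (norm_trunc_le h n))
  refine ⟨h1', ?_⟩
  have hb : ∀ x, ‖trunc h n x‖ ≤ n := by
    intro x
    unfold trunc
    split_ifs with hx
    · exact hx
    · simp
  rw [memLp_two_iff_integrable_sq_norm h1'.aestronglyMeasurable]
  have hi : Integrable (fun x => (n : ℝ) * ‖trunc h n x‖) μ :=
    ((memLp_one_iff_integrable.mp h1').norm).const_mul _
  refine hi.mono ((measurable_trunc hh n).norm.pow_const 2).aestronglyMeasurable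
    (.of_forall fun x => ?_)
  have h0 := norm_nonneg (trunc h n x)
  rw [Real.norm_of_nonneg (by positivity), Real.norm_of_nonneg (by positivity)]
  nlinarith [hb x]

theorem truncLevel_spec [MeasurableSpace X] {μ : Measure X} {h : X → ℂ} (hh : Measurable h)
    (h1 : MemLp h 1 μ) (k : ℕ) :
    eLpNorm (h - trunc h (truncLevel μ h k)) 1 μ ≤ (4 : ℝ≥0∞)⁻¹ ^ k := by
  have hlim : Tendsto (fun n : ℕ => eLpNorm (h - trunc h n) 1 μ) atTop (𝓝 0) := by
    simp only [eLpNorm_one_eq_lintegral_enorm]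
    have := tendsto_lintegral_of_dominated_convergence (μ := μ)
      (F := fun n x => ‖(h - trunc h n) x‖ₑ) (f := fun _ => 0) (fun x => ‖h x‖ₑ)
      (fun n => (hh.sub (measurable_trunc hh n)).enorm) ?_ ?_ ?_
    · simpa using this
    · intro n
      refine .of_forall fun x => ?_
      simp only [Pi.sub_apply, trunc]
      split_ifs <;> simp
    · rw [← eLpNorm_one_eq_lintegral_enorm]
      exact h1.2.ne
    · refine .of_forall fun x => ?_
      refine tendsto_const_nhds.congr' ?_
      obtain ⟨N, hN⟩ := exists_nat_ge ‖h x‖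
      filter_upwards [eventually_ge_atTop N] with n hn
      have : ‖h x‖ ≤ n := hN.trans (by exact_mod_cast hn)
      simp [trunc, this]
  have hne : {n : ℕ | eLpNorm (h - trunc h n) 1 μ ≤ (4 : ℝ≥0∞)⁻¹ ^ k}.Nonempty := by
    have hpos : (0 : ℝ≥0∞) < (4 : ℝ≥0∞)⁻¹ ^ k := by
      apply ENNReal.pow_pos
      simp
    exact (hlim.eventually (eventually_le_nhds hpos)).exists
  exact Nat.sInf_mem hne

/-- Every bounded continuation `L¹ → L^{1,∞}` of `T` is given by `applyL1 T`. -/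
theorem IsWeakExtension.ae_eq_applyL1 [MeasurableSpace X] {μ : Measure X}
    {T : Lp ℂ 2 μ →L[ℂ] Lp ℂ 2 μ} {S : Lp ℂ 1 μ →ₗ[ℂ] (X →ₘ[μ] ℂ)} (hS : IsWeakExtension T S)
    {h : X → ℂ} (hh : Measurable h) (h1 : MemLp h 1 μ) :
    S (h1.toLp h) =ᵐ[μ] applyL1 T h := by
  obtain ⟨C, hC⟩ := hS.weak_type
  set u : ℕ → X → ℂ := fun k => trunc h (truncLevel μ h k) with hu
  have hu1 : ∀ k, MemLp (u k) 1 μ := fun k => (memLp_trunc hh h1 _).1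
  have hu2 : ∀ k, MemLp (u k) 2 μ := fun k => (memLp_trunc hh h1 _).2
  let E : ℕ → Set X := fun k =>
    {x | (((2 : ℝ≥0)⁻¹ ^ k : ℝ≥0) : ℝ≥0∞) < ‖S ((h1.sub (hu1 k)).toLp _) x‖ₑ}
  have hE : ∀ k, μ (E k) ≤ C * (2 : ℝ≥0∞)⁻¹ ^ k := by
    intro k
    have h3 := hC ((h1.sub (hu1 k)).toLp _) ((2 : ℝ≥0)⁻¹ ^ k) (by positivity)
    rw [Lp.enorm_toLp] at h3
    have h4 := h3.trans (mul_le_mul_right (truncLevel_spec hh h1 k) _)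
    have h5 : ((((2 : ℝ≥0)⁻¹ ^ k : ℝ≥0)) : ℝ≥0∞) = (2 : ℝ≥0∞)⁻¹ ^ k := by
      rw [ENNReal.coe_pow, ENNReal.coe_inv (by norm_num)]
      rfl
    have h6 : (4 : ℝ≥0∞)⁻¹ ^ k = (2 : ℝ≥0∞)⁻¹ ^ k * (2 : ℝ≥0∞)⁻¹ ^ k := by
      rw [← mul_pow, ← ENNReal.mul_inv (by simp) (by simp)]
      norm_num
    change _ * μ (E k) ≤ _ at h4
    rw [h5, h6, mul_left_comm] at h4
    refine (ENNReal.mul_le_mul_iff_right ?_ ?_).mp h4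
    · exact (ENNReal.pow_pos (by simp) k).ne'
    · exact ENNReal.pow_ne_top (by simp)
  have hsum : ∑' k, μ (E k) ≠ ∞ := by
    refine ne_top_of_le_ne_top ?_ (ENNReal.tsum_le_tsum hE)
    rw [ENNReal.tsum_mul_left, ENNReal.tsum_geometric]
    refine ENNReal.mul_ne_top ENNReal.coe_ne_top ?_
    simp [ENNReal.one_sub_inv_two]
  have hsub : ∀ k, S ((h1.sub (hu1 k)).toLp _) =ᵐ[μ]
      fun x => S (h1.toLp h) x - applyL2 T (u k) x := by
    intro k
    rw [MemLp.toLp_sub h1 (hu1 k), map_sub]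
    filter_upwards [AEEqFun.coeFn_sub (S (h1.toLp h)) (S ((hu1 k).toLp (u k))),
      hS.agree (u k) (hu1 k) (hu2 k)] with x hx hx'
    rw [hx, Pi.sub_apply, hx']
  filter_upwards [ae_eventually_notMem hsum, ae_all_iff.mpr hsub] with x hx hx'
  refine (Tendsto.limUnder_eq ?_).symm
  rw [tendsto_iff_norm_sub_tendsto_zero]
  refine squeeze_zero' (.of_forall fun _ => norm_nonneg _) ?_
    (tendsto_pow_atTop_nhds_zero_of_lt_one (r := (2 : ℝ)⁻¹) (by norm_num) (by norm_num))
  filter_upwards [hx] with k hk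
  simp only [E, Set.mem_ofPred_eq, not_lt, hx' k] at hk
  rw [norm_sub_rev]
  have h7 : ‖S (h1.toLp h) x - applyL2 T (u k) x‖₊ ≤ (2 : ℝ≥0)⁻¹ ^ k := by
    exact_mod_cast hk
  exact_mod_cast h7

end

end FracBloom

namespace FracBloom

noncomputable section

variable {X : Type*}

/-! ### Geometry of spaces of homogeneous type -/

/-! Fix a ball B = B(x₀, r). Non-degeneracy at a large scale Ar gives a point y₀ with d(x₀, y₀)
comparable to Ar and κ = K(x₀, y₀) satisfying |κ|⁻¹ ≤ c₀ μ(B(x₀, Ar)). Put B' = B(y₀, r). By kernel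
regularity, |K - κ| ≤ |κ|/6 on B × B' once A is large (`IsCZKernel.norm_sub_le`). For |f| ≤ 1
supported in B' and x in B, the commutator is the integral of K(x, y)(b(x) - b(y))f(y)
(`commutator_eq_integral`). Freezing K at κ and applying Hölder gives ∫_B |∫_{B'} (b(x) - b(y)) f(y)
dy| dx ≤ Φ + D/6, where D = ∫_B ∫_{B'} |b(x) - b(y)| and Φ = |κ|⁻¹ Θ (∫_{B'} λ₁^p)^{1/p} (∫_B
λ₂^{-q'})^{1/q'}.

Two test functions suffice: f = 1, and the conjugate phase of b - ⟨b⟩_B. Together they bound D by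
3(Φ + D/6). Since D is finite, the error can be absorbed, and this controls the oscillation of b on
B by 4Φ/μ(B') (`lintegral_sub_average_le`). This works directly for complex b.

The rest is about weights. The two Muckenhoupt conditions trade the factors of Φ for reciprocals of
(∫_B λ₁^{-p'})^{1/p'} and (∫_B λ₂^q)^{1/q}. A three-factor Hölder inequality, based on ν^{1/p+1/q'}
= λ₁/λ₂, bounds these reciprocals by ν(B)^{1/p+1/q'} (`wmeas_rpow_mul_le_wmeas_bloomWeight`).
Doubling cancels the remaining measures, and 1/p + 1/q' = 1 + α/ℚ is the normalisation of the BMO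
norm. -/

theorem qball_mono (d : X → X → ℝ) (x : X) {r R : ℝ} (hr : r ≤ R) : qball d x r ⊆ qball d x R :=
  fun _ hy => lt_of_lt_of_le hy hr

section Geometry

variable [TopologicalSpace X] [MeasurableSpace X] [BorelSpace X] {d : X → X → ℝ} {μ : Measure X}
  {A₀ A₁ : ℝ}

theorem IsHomogeneousType.mem_qball_self (h : IsHomogeneousType d μ A₀ A₁) (x : X) {r : ℝ}
    (hr : 0 < r) : x ∈ qball d x r := by
  simpa [qball, (h.dist_eq_zero x x).2 rfl] using hr

theorem IsHomogeneousType.qball_subset_qball (h : IsHomogeneousType d μ A₀ A₁) {x z : X} {r R : ℝ}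
    (hR : A₀ * (d x z + r) ≤ R) : qball d z r ⊆ qball d x R := by
  intro y hy
  have h1 := h.quasi_triangle x y z
  have h0 : 0 < A₀ := lt_of_lt_of_le one_pos h.one_le_quasi
  have h2 : A₀ * (d x z + d z y) < A₀ * (d x z + r) := by
    have : d z y < r := hy
    gcongr
  exact h1.trans_lt (h2.trans_le hR)

theorem IsHomogeneousType.measure_qball_pos (h : IsHomogeneousType d μ A₀ A₁) (x : X) {r : ℝ}
    (hr : 0 < r) : 0 < μ (qball d x r) := by
  have := h.ball_pos x (r / 2) (by positivity)
  rwa [mul_div_cancel₀ r two_ne_zero] at this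

theorem IsHomogeneousType.measure_qball_two_pow (h : IsHomogeneousType d μ A₀ A₁) (x : X) {r : ℝ}
    (hr : 0 < r) (n : ℕ) :
    μ (qball d x (2 ^ n * r)) ≤ ENNReal.ofReal A₁ ^ n * μ (qball d x r) := by
  induction n with
  | zero => simp
  | succ n ih =>
    have h1 := h.doubling x (2 ^ n * r) (by positivity)
    rw [← mul_assoc, ← pow_succ'] at h1
    refine h1.trans ?_
    rw [pow_succ', mul_assoc]
    gcongr

theorem IsHomogeneousType.measure_qball_le (h : IsHomogeneousType d μ A₀ A₁) (x : X) {r R : ℝ}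
    (hr : 0 < r) {n : ℕ} (hR : R ≤ 2 ^ n * r) :
    μ (qball d x R) ≤ ENNReal.ofReal A₁ ^ n * μ (qball d x r) :=
  (measure_mono (qball_mono d x hR)).trans (h.measure_qball_two_pow x hr n)

theorem IsHomogeneousType.measureReal_qball_le (h : IsHomogeneousType d μ A₀ A₁) (x : X)
    {r R : ℝ} (hr : 0 < r) {n : ℕ} (hR : R ≤ 2 ^ n * r) :
    μ.real (qball d x R) ≤ A₁ ^ n * μ.real (qball d x r) := by
  have h1 := ENNReal.toReal_mono
    (ENNReal.mul_ne_top (by simp) (h.ball_lt_top x r hr).ne) (h.measure_qball_le x hr hR)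
  rwa [ENNReal.toReal_mul, ENNReal.toReal_pow,
    ENNReal.toReal_ofReal (zero_le_one.trans h.one_le_doubling)] at h1

/-- Every ball is a neighbourhood of its centre. -/
theorem IsHomogeneousType.qball_mem_nhds (h : IsHomogeneousType d μ A₀ A₁) (x : X) {r : ℝ}
    (hr : 0 < r) : qball d x r ∈ 𝓝 x := by
  have h0 : 0 < A₀ := lt_of_lt_of_le one_pos h.one_le_quasi
  -- Quasi-metric balls need not be open. The open set used is that of all points with some ball
  -- inside B(x, r): if B(z, s) lies in it, halving the radius and dividing by A₀ leaves room for a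
  -- ball around each nearby point.
  refine mem_nhds_iff.2 ⟨{z | ∃ s > 0, qball d z s ⊆ qball d x r}, ?_, ?_, r, hr, subset_rfl⟩
  · rintro z ⟨s, hs, hz⟩
    exact hz (h.mem_qball_self z hs)
  · refine (h.isOpen_iff _).2 ?_
    rintro z ⟨s, hs, hz⟩
    refine ⟨s / (2 * A₀), by positivity, fun y hy => ⟨s / (2 * A₀), by positivity, ?_⟩⟩
    refine (h.qball_subset_qball ?_).trans hz
    have : d z y < s / (2 * A₀) := hy
    calc A₀ * (d z y + s / (2 * A₀)) ≤ A₀ * (s / (2 * A₀) + s / (2 * A₀)) := by gcongr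
      _ = s := by field_simp; ring

theorem IsHomogeneousType.notMem_closure (h : IsHomogeneousType d μ A₀ A₁) {x : X} {r : ℝ}
    (hr : 0 < r) {S : Set X} (hS : ∀ y ∈ S, r ≤ d x y) : x ∉ closure S := by
  rw [mem_closure_iff_nhds]
  intro hx
  obtain ⟨y, hy, hyS⟩ := hx _ (h.qball_mem_nhds x hr)
  exact absurd (hS y hyS) (not_le.2 hy)

/-- Test functions live on balls, while `MemLinftyBs` bounds the topological support. One use of the
quasi-triangle inequality pays for the closure. -/
theorem IsHomogeneousType.closure_qball_subset (h : IsHomogeneousType d μ A₀ A₁) (x : X) {r : ℝ}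
    (hr : 0 < r) : closure (qball d x r) ⊆ qball d x (2 * A₀ * r) := by
  have h0 : 0 < A₀ := lt_of_lt_of_le one_pos h.one_le_quasi
  intro y hy
  obtain ⟨z, hzy, hzx⟩ := mem_closure_iff_nhds.1 hy _ (h.qball_mem_nhds y hr)
  have h1 : d y z < r := hzy
  have h2 : d x z < r := hzx
  have h3 := h.quasi_triangle x y z
  rw [h.dist_symm z y] at h3
  change d x y < _
  nlinarith

end Geometry

/-! ### Kernel estimates -/

theorem IsModulus.exists_le {ω : ℝ → ℝ} (hω : IsModulus ω) {ε : ℝ} (hε : 0 < ε) :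
    ∃ η : ℝ, 0 < η ∧ η ≤ 1 ∧ ∀ t, 0 ≤ t → t ≤ η → ω t ≤ ε := by
  have h0 : (0 : ℝ) ∈ Set.Icc (0 : ℝ) 1 := ⟨le_rfl, zero_le_one⟩
  obtain ⟨δ, hδ, H⟩ := Metric.continuousWithinAt_iff.1 (hω.continuousOn 0 h0) ε hε
  refine ⟨min (δ / 2) 1, by positivity, min_le_right _ _, fun t ht ht' => ?_⟩
  have h1 : t ≤ δ / 2 := ht'.trans (min_le_left _ _)
  have h2 := H (x := t) ⟨ht, ht'.trans (min_le_right _ _)⟩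
    (by rw [Real.dist_eq, sub_zero, abs_of_nonneg ht]; linarith)
  rw [hω.zero, Real.dist_eq, sub_zero] at h2
  exact (le_abs_self _).trans h2.le

section Kernel

variable [TopologicalSpace X] [MeasurableSpace X] [BorelSpace X] {d : X → X → ℝ} {μ : Measure X}
  {A₀ A₁ cK : ℝ} {ω : ℝ → ℝ} {K : X → X → ℂ}

/-- The kernel is not assumed measurable. Regularity in the second variable, with ω small near 0,
gives continuity off the diagonal, and from it measurability on sets away from x. -/
theorem IsCZKernel.continuousOn (h : IsHomogeneousType d μ A₀ A₁) (hω : IsModulus ω)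
    (hK : IsCZKernel d μ A₀ cK ω K) (x : X) : ContinuousOn (K x) {x}ᶜ := by
  have h0 : 0 < A₀ := lt_of_lt_of_le one_pos h.one_le_quasi
  intro y hy
  refine ContinuousAt.continuousWithinAt (Metric.continuousAt_iff'.2 fun ε hε => ?_)
  have hyx : 0 < d y x := lt_of_le_of_ne (h.dist_nonneg y x)
    (fun h' => hy ((h.dist_eq_zero y x).1 h'.symm))
  have hV : 0 < vol d μ y x :=
    ENNReal.toReal_pos (h.measure_qball_pos y hyx).ne' (h.ball_lt_top y _ hyx).ne
  obtain ⟨η, hη, -, H⟩ := hω.exists_le (ε := ε / 2 * vol d μ y x) (by positivity)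
  filter_upwards [h.qball_mem_nhds y (r := min ((2 * A₀)⁻¹ * d y x) (η * d y x)) (by positivity)]
    with z hz
  have hz1 : d y z < (2 * A₀)⁻¹ * d y x := lt_of_lt_of_le hz (min_le_left _ _)
  have hz2 : d y z < η * d y x := lt_of_lt_of_le hz (min_le_right _ _)
  have h1 := hK.regularity y z x hz1
  have h2 := H (d y z / d y x) (div_nonneg (h.dist_nonneg _ _) hyx.le)
    ((div_le_iff₀ hyx).2 hz2.le)
  have h3 : 1 / vol d μ y x * ω (d y z / d y x) ≤ ε / 2 := by
    rw [div_mul_eq_mul_div, one_mul, div_le_iff₀ hV]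
    exact h2
  rw [dist_comm, dist_eq_norm]
  linarith [norm_nonneg (K y x - K z x)]

/-- Points of two far away balls of the same radius are separated. -/
theorem IsHomogeneousType.separated (h : IsHomogeneousType d μ A₀ A₁) {A r : ℝ} {x₀ y₀ x y : X}
    (hA : 4 * A₀ ^ 2 ≤ A) (hr : 0 < r) (hxy : A * r ≤ d x₀ y₀) (hx : x ∈ qball d x₀ r)
    (hy : y ∈ qball d y₀ r) : A * r ≤ 2 * A₀ * d y₀ x ∧ r ≤ d x y := by
  have h1 := h.one_le_quasi
  have hx' : d x₀ x < r := hx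
  have hy' : d y₀ y < r := hy
  have h2 := h.quasi_triangle x₀ y₀ x
  rw [h.dist_symm x y₀] at h2
  have h3 := h.quasi_triangle y₀ x y
  rw [h.dist_symm y x] at h3
  have hAr : 4 * A₀ ^ 2 * r ≤ A * r := by gcongr
  -- The term A₀r in the quasi-triangle bound is at most Ar/4, so it is absorbed into the left side.
  have h4 : A * r ≤ 2 * A₀ * d y₀ x := by
    have h5 : A * r ≤ A₀ * (r + d y₀ x) := (hxy.trans h2).trans (by gcongr)
    have h6 : A₀ * r ≤ A₀ ^ 2 * r := by gcongr; nlinarith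
    nlinarith
  refine ⟨h4, ?_⟩
  -- If d(x, y) < r then d(y₀, x) < 2A₀r, so Ar < 4A₀²r: this is where the threshold 4A₀² comes
  -- from.
  by_contra! hlt
  have h5 : d y₀ x < A₀ * (r + r) := h3.trans_lt (by gcongr)
  nlinarith

/-- On the product of two far away balls the kernel is almost constant. -/
theorem IsCZKernel.norm_sub_le (h : IsHomogeneousType d μ A₀ A₁) (hω : IsModulus ω)
    (hK : IsCZKernel d μ A₀ cK ω K) {A r C : ℝ} {m : ℕ} {x₀ y₀ x y : X}
    (hA : 4 * A₀ ^ 2 ≤ A) (hr : 0 < r) (hm : 2 * A₀ ^ 2 * (C + 1) ≤ 2 ^ m)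
    (hxy : A * r ≤ d x₀ y₀) (hxy' : d x₀ y₀ < C * (A * r)) (hx : x ∈ qball d x₀ r)
    (hy : y ∈ qball d y₀ r) :
    ‖K x y - K x₀ y₀‖ ≤ (1 + A₁ ^ m) * ω (2 * A₀ / A) / μ.real (qball d x₀ (A * r)) := by
  have h1 := h.one_le_quasi
  have hA0 : 0 < A₀ := by linarith
  have hA' : 2 * A₀ ≤ A := by nlinarith
  have hApos : 0 < A := by linarith
  have hAr : 0 < A * r := by positivity
  have hx' : d x₀ x < r := hx
  have hy' : d y₀ y < r := hy
  have hd : 0 < d x₀ y₀ := hAr.trans_le hxy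
  obtain ⟨hsep, -⟩ := h.separated hA hr hxy hx hy
  have hdx : 0 < d y₀ x := by
    by_contra! hle
    nlinarith
  have hI : 2 * A₀ / A ∈ Set.Icc (0 : ℝ) 1 := ⟨by positivity, (div_le_one hApos).2 hA'⟩
  have hω0 : 0 ≤ ω (2 * A₀ / A) := hω.nonneg _ hI
  have hV0 : 0 < μ.real (qball d x₀ (A * r)) :=
    ENNReal.toReal_pos (h.measure_qball_pos _ hAr).ne' (h.ball_lt_top _ _ hAr).ne
  -- The kernel is moved from (x₀, y₀) to (x, y₀) and then to (x, y); both relative displacements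
  -- are at most 2A₀/A.
  have mono : ∀ {s t : ℝ}, 0 ≤ s → 0 < t → s * A ≤ 2 * A₀ * t → ω (s / t) ≤ ω (2 * A₀ / A) := by
    intro s t hs ht hst
    have hle : s / t ≤ 2 * A₀ / A := by rwa [div_le_div_iff₀ ht hApos]
    exact hω.monotoneOn ⟨by positivity, hle.trans hI.2⟩ hI hle
  have e1 : ‖K x₀ y₀ - K x y₀‖ ≤ ω (2 * A₀ / A) / μ.real (qball d x₀ (A * r)) := by
    have hlt : d x₀ x < (2 * A₀)⁻¹ * d x₀ y₀ := by
      rw [lt_inv_mul_iff₀ (by positivity)]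
      nlinarith
    have hreg := hK.regularity x₀ x y₀ hlt
    have hV : μ.real (qball d x₀ (A * r)) ≤ vol d μ x₀ y₀ :=
      measureReal_mono (qball_mono d x₀ hxy) (h.ball_lt_top _ _ hd).ne
    calc ‖K x₀ y₀ - K x y₀‖ ≤ 1 / vol d μ x₀ y₀ * ω (d x₀ x / d x₀ y₀) := by
          linarith [norm_nonneg (K y₀ x₀ - K y₀ x)]
      _ ≤ 1 / vol d μ x₀ y₀ * ω (2 * A₀ / A) := by
          have := mono (h.dist_nonneg x₀ x) hd (by nlinarith)
          have := hV0.trans_le hV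
          gcongr
      _ ≤ 1 / μ.real (qball d x₀ (A * r)) * ω (2 * A₀ / A) := by gcongr
      _ = _ := by rw [div_mul_eq_mul_div, one_mul]
  have e2 : ‖K x y₀ - K x y‖ ≤ A₁ ^ m * ω (2 * A₀ / A) / μ.real (qball d x₀ (A * r)) := by
    have hlt : d y₀ y < (2 * A₀)⁻¹ * d y₀ x := by
      rw [lt_inv_mul_iff₀ (by positivity)]
      have h2 : 4 * A₀ ^ 2 * r ≤ A * r := by gcongr
      have h3 : 2 * A₀ * (2 * A₀ * r) ≤ 2 * A₀ * d y₀ x := by linarith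
      exact (by gcongr : 2 * A₀ * d y₀ y < 2 * A₀ * r).trans_le
        (le_of_mul_le_mul_left h3 (by positivity))
    have hreg := hK.regularity y₀ y x hlt
    have hVpos : 0 < vol d μ y₀ x :=
      ENNReal.toReal_pos (h.measure_qball_pos _ hdx).ne' (h.ball_lt_top _ _ hdx).ne
    -- The second move carries the volume at y₀. The choice of m makes m doublings of B(y₀, d(y₀,
    -- x)) cover B(x₀, Ar).
    have hV : μ.real (qball d x₀ (A * r)) ≤ A₁ ^ m * vol d μ y₀ x := by
      have hbig : A₀ * (d y₀ x₀ + A * r) ≤ 2 ^ m * d y₀ x := by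
        rw [h.dist_symm y₀ x₀]
        have hC : 0 < C := by
          by_contra! hle
          nlinarith
        calc A₀ * (d x₀ y₀ + A * r) ≤ A₀ * (C * (A * r) + A * r) := by gcongr
          _ = A₀ * (C + 1) * (A * r) := by ring
          _ ≤ A₀ * (C + 1) * (2 * A₀ * d y₀ x) := by gcongr
          _ = 2 * A₀ ^ 2 * (C + 1) * d y₀ x := by ring
          _ ≤ 2 ^ m * d y₀ x := by gcongr
      refine le_trans (measureReal_mono (h.qball_subset_qball (x := y₀) le_rfl) ?_)
        (h.measureReal_qball_le y₀ hdx hbig)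
      exact (h.ball_lt_top _ _ (by have := h.dist_nonneg y₀ x₀; positivity)).ne
    calc ‖K x y₀ - K x y‖ ≤ 1 / vol d μ y₀ x * ω (d y₀ y / d y₀ x) := by
          linarith [norm_nonneg (K y₀ x - K y x)]
      _ ≤ 1 / vol d μ y₀ x * ω (2 * A₀ / A) := by
          have := mono (h.dist_nonneg y₀ y) hdx (by nlinarith)
          gcongr
      _ = ω (2 * A₀ / A) / vol d μ y₀ x := by rw [div_mul_eq_mul_div, one_mul]
      _ ≤ _ := by
          rw [div_le_div_iff₀ hVpos hV0]
          nlinarith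
  calc ‖K x y - K x₀ y₀‖ = ‖(K x₀ y₀ - K x y₀) + (K x y₀ - K x y)‖ := by
        rw [← norm_neg]; congr 1; ring
    _ ≤ _ := (norm_add_le _ _).trans (add_le_add e1 e2)
    _ = _ := by ring

end Kernel

/-! ### Off-diagonal representation of the commutator -/

theorem tsupport_trunc_subset [TopologicalSpace X] {h : X → ℂ} {S : Set X}
    (hS : ∀ y ∉ S, h y = 0) (n : ℕ) : tsupport (trunc h n) ⊆ closure S := by
  refine closure_mono fun y hy => ?_
  by_contra hyS
  exact hy (by simp [trunc, hS y hyS])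

/-- The integral against a bounded function of the truncations converges. -/
theorem tendsto_integral_mul_trunc [MeasurableSpace X] {μ : Measure X} {h k : X → ℂ} {S : Set X}
    {M : ℝ} (hS : MeasurableSet S) (hh : Measurable h) (h1 : MemLp h 1 μ)
    (h0 : ∀ y ∉ S, h y = 0) (hk : AEStronglyMeasurable k (μ.restrict S))
    (hM : ∀ y ∈ S, ‖k y‖ ≤ M) :
    Tendsto (fun n : ℕ => ∫ y, k y * trunc h (truncLevel μ h n) y ∂μ) atTop
      (𝓝 (∫ y, k y * h y ∂μ)) := by
  -- Only the values of k on S are controlled, so k is cut off to S; the functions it multiplies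
  -- vanish elsewhere.
  have key : ∀ u : X → ℂ, (∀ y ∉ S, u y = 0) →
      ∫ y, k y * u y ∂μ = ∫ y, S.indicator k y * u y ∂μ := by
    intro u hu
    congr 1 with y
    by_cases hy : y ∈ S
    · simp [hy]
    · simp [hy, hu y hy]
  have h0' : ∀ n, ∀ y ∉ S, trunc h n y = 0 := fun n y hy => by simp [trunc, h0 y hy]
  simp only [key _ (h0' _), key h h0]
  have hm : AEStronglyMeasurable (S.indicator k) μ := (aestronglyMeasurable_indicator_iff hS).2 hk
  have hb : ∀ y, ‖S.indicator k y‖ ≤ max M 0 := by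
    intro y
    by_cases hy : y ∈ S
    · simpa [hy] using Or.inl (hM y hy)
    · simp [hy]
  have hint : ∀ {u : X → ℂ}, MemLp u 1 μ → Integrable (fun y => S.indicator k y * u y) μ :=
    fun hu => (memLp_one_iff_integrable.1 hu).bdd_mul hm (.of_forall hb)
  refine tendsto_iff_edist_tendsto_0.2 ?_
  have hlim : Tendsto (fun n : ℕ => ENNReal.ofReal (max M 0) * (4 : ℝ≥0∞)⁻¹ ^ n) atTop (𝓝 0) := by
    have := ENNReal.Tendsto.const_mul (a := ENNReal.ofReal (max M 0))
      (ENNReal.tendsto_pow_atTop_nhds_zero_of_lt_one (r := (4 : ℝ≥0∞)⁻¹)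
        (ENNReal.inv_lt_one.2 (by norm_num))) (Or.inr ENNReal.ofReal_ne_top)
    simpa using this
  refine tendsto_of_tendsto_of_tendsto_of_le_of_le tendsto_const_nhds hlim
    (fun _ => zero_le) fun n => ?_
  rw [edist_comm, edist_eq_enorm_sub, ← integral_sub (hint h1) (hint (memLp_trunc hh h1 _).1)]
  refine (enorm_integral_le_lintegral_enorm _).trans ?_
  refine le_trans ?_ (mul_le_mul_right (truncLevel_spec hh h1 n) _)
  rw [eLpNorm_one_eq_lintegral_enorm, ← lintegral_const_mul' _ _ ENNReal.ofReal_ne_top]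
  refine lintegral_mono fun y => ?_
  rw [← mul_sub, enorm_mul, Pi.sub_apply]
  gcongr
  rw [← ofReal_norm]
  exact ENNReal.ofReal_le_ofReal (hb y)

/-- Each truncation of bf is in L² and supported in the closure of S', so the kernel formula holds
for all truncations simultaneously off one null set. Boundedness of K(x, ·) on S' carries it to the
limit defining `applyL1`, where bf is only integrable. -/
theorem commutator_eq_integral [TopologicalSpace X] [MeasurableSpace X] {μ : Measure X}
    {K : X → X → ℂ} {T : Lp ℂ 2 μ →L[ℂ] Lp ℂ 2 μ} (hT : HasKernel T K) {b f : X → ℂ}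
    (hb : Measurable b) (hf : Measurable f) {S S' : Set X} {M : ℝ} (hS' : MeasurableSet S')
    (hμ : μ S' ≠ ∞) (hbS : IntegrableOn b S' μ) (hf1 : ∀ y, ‖f y‖ ≤ 1) (hf0 : ∀ y ∉ S', f y = 0)
    (hsep : ∀ x ∈ S, x ∉ closure S')
    (hK : ∀ x ∈ S, AEStronglyMeasurable (K x) (μ.restrict S'))
    (hM : ∀ x ∈ S, ∀ y ∈ S', ‖K x y‖ ≤ M) :
    ∀ᵐ x ∂μ, x ∈ S → commutator b T f x = ∫ y in S', K x y * ((b x - b y) * f y) ∂μ := by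
  have hf2 : ∀ s : ℝ≥0∞, MemLp f s μ := by
    intro s
    have h1 : MemLp (S'.indicator (fun _ => (1 : ℂ))) s μ :=
      memLp_indicator_const s hS' 1 (Or.inr hμ)
    refine h1.mono hf.aestronglyMeasurable (.of_forall fun y => ?_)
    by_cases hy : y ∈ S'
    · simpa [hy] using hf1 y
    · simp [hy, hf0 y hy]
  set h : X → ℂ := fun y => b y * f y with hdef
  have hh : Measurable h := hb.mul hf
  have hh0 : ∀ y ∉ S', h y = 0 := fun y hy => by simp [hdef, hf0 y hy]
  have hbi : Integrable (S'.indicator b) μ := (integrable_indicator_iff hS').2 hbS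
  have hh1 : MemLp h 1 μ := by
    refine memLp_one_iff_integrable.2 (hbi.mono hh.aestronglyMeasurable (.of_forall fun y => ?_))
    by_cases hy : y ∈ S'
    · simpa [hy, hdef] using mul_le_of_le_one_right (norm_nonneg (b y)) (hf1 y)
    · simp [hh0 y hy]
  have hfs : tsupport f ⊆ closure S' := closure_mono fun y hy => by
    by_contra hyS
    exact hy (hf0 y hyS)
  filter_upwards [hT f hf (hf2 2), ae_all_iff.2 fun k : ℕ =>
    hT (trunc h (truncLevel μ h k)) (measurable_trunc hh _) (memLp_trunc hh hh1 _).2]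
    with x hx1 hx2 hxS
  have e1 : applyL2 T f x = ∫ y, K x y * f y ∂μ := hx1 fun h' => hsep x hxS (hfs h')
  have e2 : applyL1 T h x = ∫ y, K x y * h y ∂μ := by
    refine Tendsto.limUnder_eq ?_
    refine (tendsto_integral_mul_trunc hS' hh hh1 hh0 (hK x hxS) (hM x hxS)).congr fun k => ?_
    exact (hx2 k fun h' => hsep x hxS (tsupport_trunc_subset hh0 _ h')).symm
  have restr : ∀ u : X → ℂ, (∀ y ∉ S', u y = 0) →
      ∫ y, K x y * u y ∂μ = ∫ y in S', K x y * u y ∂μ := by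
    intro u hu
    refine (setIntegral_eq_integral_of_forall_compl_eq_zero fun y hy => ?_).symm
    rw [hu y hy, mul_zero]
  have hint : ∀ {u : X → ℂ}, MemLp u 1 μ →
      Integrable (fun y => K x y * u y) (μ.restrict S') := fun hu =>
    (memLp_one_iff_integrable.1 hu).restrict.bdd_mul (hK x hxS)
      ((ae_restrict_iff' hS').2 (.of_forall (hM x hxS)))
  unfold commutator
  rw [e1, e2, restr f hf0, restr h hh0, ← integral_const_mul,
    ← integral_sub ((hint (hf2 1)).const_mul _) (hint hh1)]
  congr 1 with y
  simp only [hdef]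
  ring

/-! ### Oscillation -/

/-- A double oscillation `∫_S ∫_{S'} |b(x) - b(y)|` is controlled by testing against functions
bounded by one, up to an error that can be absorbed. -/
theorem lintegral_sub_average_le [MeasurableSpace X] {μ : Measure X} {b : X → ℂ}
    (hb : Measurable b) {S S' : Set X} (hμ : μ S ≠ 0) (hμ' : μ S' ≠ 0) (hμt : μ S ≠ ∞)
    (hμt' : μ S' ≠ ∞) (hbS : IntegrableOn b S μ) (hbS' : IntegrableOn b S' μ) {Φ : ℝ≥0∞}
    (H : ∀ f : X → ℂ, Measurable f → (∀ y, ‖f y‖ ≤ 1) →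
      ∫⁻ x in S, ‖∫ y in S', (b x - b y) * f y ∂μ‖ₑ ∂μ ≤
        Φ + 6⁻¹ * ∫⁻ x in S, ∫⁻ y in S', ‖b x - b y‖ₑ ∂μ ∂μ) :
    ∫⁻ x in S, ‖b x - ⨍ z in S, b z ∂μ‖ₑ ∂μ ≤ 4 * Φ / μ S' := by
  have : IsFiniteMeasure (μ.restrict S) := isFiniteMeasure_restrict.2 hμt
  have : IsFiniteMeasure (μ.restrict S') := isFiniteMeasure_restrict.2 hμt'
  set D := ∫⁻ x in S, ∫⁻ y in S', ‖b x - b y‖ₑ ∂μ ∂μ with hD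
  set c := ⨍ z in S, b z ∂μ with hc
  set c' := ⨍ z in S', b z ∂μ with hc'
  have hm : μ.real S ≠ 0 := (ENNReal.toReal_pos hμ hμt).ne'
  have hm' : μ.real S' ≠ 0 := (ENNReal.toReal_pos hμ' hμt').ne'
  have avg : ∫ z in S, b z ∂μ = μ.real S * c := by
    rw [hc, setAverage_eq, Complex.real_smul, Complex.ofReal_inv, mul_inv_cancel_left₀]
    exact_mod_cast hm
  have avg' : ∫ z in S', b z ∂μ = μ.real S' * c' := by
    rw [hc', setAverage_eq, Complex.real_smul, Complex.ofReal_inv, mul_inv_cancel_left₀]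
    exact_mod_cast hm'
  have real_enorm : ∀ {Z : Set X}, μ Z ≠ ∞ → ‖(μ.real Z : ℂ)‖ₑ = μ Z := by
    intro Z hZ
    rw [← ofReal_norm, Complex.norm_real, Real.norm_of_nonneg measureReal_nonneg,
      ofReal_measureReal hZ]
  have upper : ∀ a : ℂ, D ≤ μ S' * ∫⁻ x in S, ‖b x - a‖ₑ ∂μ + μ S * ∫⁻ y in S', ‖b y - a‖ₑ ∂μ := by
    intro a
    calc D ≤ ∫⁻ x in S, ∫⁻ y in S', (‖b x - a‖ₑ + ‖b y - a‖ₑ) ∂μ ∂μ := by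
          refine lintegral_mono fun x => lintegral_mono fun y => ?_
          rw [← sub_sub_sub_cancel_right (b x) (b y) a]
          exact enorm_sub_le
      _ = ∫⁻ x in S, (‖b x - a‖ₑ * μ S' + ∫⁻ y in S', ‖b y - a‖ₑ ∂μ) ∂μ := by
          congr 1 with x
          rw [lintegral_add_left measurable_const, setLIntegral_const]
      _ = _ := by
          rw [lintegral_add_right _ measurable_const, setLIntegral_const,
            lintegral_mul_const _ (by fun_prop), mul_comm (μ S'), mul_comm (μ S)]
  -- Finiteness of D, from local integrability of b, is what allows the absorption below.
  have hDtop : D ≠ ∞ := by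
    refine ne_top_of_le_ne_top ?_ (upper 0)
    simp only [sub_zero]
    exact ENNReal.add_ne_top.2 ⟨ENNReal.mul_ne_top hμt' hbS.2.ne,
      ENNReal.mul_ne_top hμt hbS'.2.ne⟩
  set Ψ := Φ + 6⁻¹ * D with hΨ
  have osc' : μ S' * ∫⁻ x in S, ‖b x - c'‖ₑ ∂μ ≤ Ψ := by
    refine le_trans (le_of_eq ?_) (H (fun _ => 1) measurable_const (by simp))
    rw [← lintegral_const_mul _ (by fun_prop)]
    congr 1 with x
    simp only [mul_one]
    rw [integral_sub (integrable_const _) hbS', avg', setIntegral_const, Complex.real_smul,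
      ← mul_sub, enorm_mul, real_enorm hμt']
  have osc : μ S * ∫⁻ y in S', ‖b y - c‖ₑ ∂μ ≤ Ψ := by
    -- The conjugate phase of b - c, with value 0 where b = c. Since b - c has mean zero on S,
    -- integrating over x leaves -μ(S) ∫_{S'} |b - c|.
    set f : X → ℂ := fun y => (starRingEnd ℂ) (b y - c) / ‖b y - c‖ with hf
    have hfm : Measurable f := by fun_prop
    have hf1 : ∀ y, ‖f y‖ ≤ 1 := fun y => by
      simp only [hf, norm_div, RCLike.norm_conj, Complex.norm_real, norm_norm]
      exact div_self_le_one _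
    have hfb : ∀ y, (b y - c) * f y = (‖b y - c‖ : ℂ) := fun y => by
      simp only [hf, ← mul_div_assoc, Complex.mul_conj']
      by_cases hy : (‖b y - c‖ : ℂ) = 0
      · simp [hy]
      · rw [sq, mul_div_assoc, div_self hy, mul_one]
    have hfi : IntegrableOn f S' μ := (integrable_const (1 : ℝ)).mono'
      hfm.aestronglyMeasurable (.of_forall hf1)
    have hbf : IntegrableOn (fun y => b y * f y) S' μ :=
      hbS'.mul_bdd hfm.aestronglyMeasurable (.of_forall hf1)
    have hbc : IntegrableOn (fun y => b y - c) S' μ := hbS'.sub (integrable_const _)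
    have inner : ∀ x, ∫ y in S', (b x - b y) * f y ∂μ =
        b x * ∫ y in S', f y ∂μ - ∫ y in S', b y * f y ∂μ := by
      intro x
      simp only [sub_mul]
      rw [integral_sub (hfi.const_mul _) hbf, integral_const_mul]
    have outer : ∫ x in S, ∫ y in S', (b x - b y) * f y ∂μ ∂μ =
        -(μ.real S * ∫ y in S', (b y - c) * f y ∂μ) := by
      simp only [inner]
      rw [integral_sub (hbS.mul_const _) (integrable_const _), integral_mul_const, avg,
        setIntegral_const, Complex.real_smul]
      simp only [sub_mul]
      rw [integral_sub hbf (hfi.const_mul _), integral_const_mul]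
      ring
    refine le_trans (le_of_eq ?_)
      ((enorm_integral_le_lintegral_enorm _).trans (H f hfm hf1))
    rw [outer, enorm_neg, enorm_mul, real_enorm hμt]
    simp only [hfb]
    rw [integral_complex_ofReal, ← ofReal_norm (_ : ℂ), Complex.norm_real,
      Real.norm_of_nonneg (integral_nonneg fun _ => norm_nonneg _),
      ofReal_integral_norm_eq_lintegral_enorm hbc]
  -- Passing from the constant c' to the mean c over S costs a factor 2, because |c' - c| is at most
  -- the mean of |b - c'| over S.
  have cc : ∫⁻ x in S, ‖b x - c‖ₑ ∂μ ≤ 2 * ∫⁻ x in S, ‖b x - c'‖ₑ ∂μ := by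
    have h1 : μ S * ‖c' - c‖ₑ ≤ ∫⁻ x in S, ‖b x - c'‖ₑ ∂μ := by
      refine le_trans (le_of_eq ?_) (enorm_integral_le_lintegral_enorm _)
      rw [integral_sub hbS (integrable_const _), avg, setIntegral_const, Complex.real_smul,
        ← mul_sub, enorm_mul, real_enorm hμt, ← enorm_neg, neg_sub]
    calc ∫⁻ x in S, ‖b x - c‖ₑ ∂μ ≤ ∫⁻ x in S, (‖b x - c'‖ₑ + ‖c' - c‖ₑ) ∂μ := by
          refine lintegral_mono fun x => ?_
          rw [← sub_add_sub_cancel (b x) c' c]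
          exact enorm_add_le _ _
      _ = ∫⁻ x in S, ‖b x - c'‖ₑ ∂μ + μ S * ‖c' - c‖ₑ := by
          rw [lintegral_add_right _ measurable_const, setLIntegral_const, mul_comm (μ S)]
      _ ≤ _ := by
          rw [two_mul]
          gcongr
  have h1 : μ S' * ∫⁻ x in S, ‖b x - c‖ₑ ∂μ ≤ 2 * Ψ := by
    calc μ S' * ∫⁻ x in S, ‖b x - c‖ₑ ∂μ ≤ μ S' * (2 * ∫⁻ x in S, ‖b x - c'‖ₑ ∂μ) := by gcongr
      _ = 2 * (μ S' * ∫⁻ x in S, ‖b x - c'‖ₑ ∂μ) := by ring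
      _ ≤ _ := by gcongr
  -- D ≤ 3Ψ = 3Φ + D/2; the factor 1/6 in the hypothesis is chosen to leave half of D.
  have h2 : D ≤ 6 * Φ := by
    rcases eq_or_ne Φ ∞ with rfl | hΦ
    · simp
    have h3 : D ≤ 2 * Ψ + Ψ := (upper c).trans (add_le_add h1 osc)
    lift D to ℝ≥0 using hDtop with D'
    lift Φ to ℝ≥0 using hΦ with Φ'
    have h6 : (6⁻¹ : ℝ≥0∞) = ((6⁻¹ : ℝ≥0) : ℝ≥0∞) := by
      rw [ENNReal.coe_inv (by norm_num)]; rfl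
    rw [hΨ, h6] at h3
    norm_cast at h3 ⊢
    rw [← NNReal.coe_le_coe] at h3 ⊢
    push_cast at h3 ⊢
    linarith
  rw [ENNReal.le_div_iff_mul_le (Or.inl hμ') (Or.inl hμt'), mul_comm]
  calc μ S' * ∫⁻ x in S, ‖b x - c‖ₑ ∂μ ≤ 2 * Ψ := h1
    _ ≤ 2 * (Φ + 6⁻¹ * (6 * Φ)) := by rw [hΨ]; gcongr
    _ = 4 * Φ := by
      rw [← mul_assoc 6⁻¹, ENNReal.inv_mul_cancel (by norm_num) (by norm_num)]
      ring

/-! ### Weights -/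

theorem wmeas_mono [MeasurableSpace X] (μ : Measure X) (w : X → ℝ) {E F : Set X} (h : E ⊆ F) :
    wmeas μ w E ≤ wmeas μ w F :=
  lintegral_mono_set h

/-- The `A_{p,p}` condition on a ball in its symmetric form. -/
theorem wmeas_rpow_mul_wmeas_rpow_le [MeasurableSpace X] {d : X → X → ℝ} {μ : Measure X} {p : ℝ}
    (hp : 1 < p) {w : X → ℝ} (hw : ∀ x, 0 < w x) {N : ℝ≥0∞} (hN : appConst d μ p w ≤ N) (x : X)
    {r : ℝ} (hr : 0 < r) (h0 : μ (qball d x r) ≠ 0) (ht : μ (qball d x r) ≠ ∞) :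
    wmeas μ (fun y => w y ^ p) (qball d x r) ^ (1 / p) *
        wmeas μ (fun y => w y ^ (-p.conjExponent)) (qball d x r) ^ (1 / p.conjExponent) ≤
      N * μ (qball d x r) := by
  have hp0 : 0 < p := by linarith
  have hp1 : 0 < p - 1 := by linarith
  have e : (fun y => (w y ^ p) ^ (-(1 / (p - 1)))) = fun y => w y ^ (-p.conjExponent) := by
    ext y
    rw [← Real.rpow_mul (hw y).le, Real.conjExponent]
    congr 1
    ring
  have h1 : wmeas μ (fun y => w y ^ p) (qball d x r) *
      wmeas μ (fun y => w y ^ (-p.conjExponent)) (qball d x r) ^ (p - 1) /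
        μ (qball d x r) ^ p ≤ apConst d μ p (fun y => w y ^ p) := by
    rw [← e]
    exact le_iSup_of_le x (le_iSup_of_le r (le_iSup_of_le hr le_rfl))
  have h2 := (ENNReal.rpow_le_rpow h1 (z := 1 / p) (by positivity)).trans hN
  rw [ENNReal.div_rpow_of_nonneg _ _ (by positivity), ENNReal.mul_rpow_of_nonneg _ _ (by positivity),
    ← ENNReal.rpow_mul, ← ENNReal.rpow_mul, mul_one_div_cancel hp0.ne', ENNReal.rpow_one,
    ENNReal.div_le_iff h0 ht] at h2
  convert h2 using 3
  rw [Real.conjExponent]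
  field_simp

/-- With s = 1/p + 1/q', the product ν^{s/2} λ₁^{-1/2} λ₂^{1/2} is identically 1. Hölder applies
with exponents s/2, 1/(2p'), 1/(2q), which sum to 1; squaring removes the halves. -/
theorem measure_sq_le_wmeas_bloomWeight [MeasurableSpace X] {μ : Measure X} {p q : ℝ} (hp : 1 < p)
    (hq : 1 < q) {w₁ w₂ : X → ℝ} (hm₁ : Measurable w₁) (hm₂ : Measurable w₂) (h₁ : ∀ x, 0 < w₁ x)
    (h₂ : ∀ x, 0 < w₂ x) (S : Set X) :
    μ S ^ 2 ≤ wmeas μ (bloomWeight p q w₁ w₂) S ^ (1 / p + 1 / q.conjExponent) *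
      (wmeas μ (fun y => w₁ y ^ (-p.conjExponent)) S ^ (1 / p.conjExponent) *
        wmeas μ (fun y => w₂ y ^ q) S ^ (1 / q)) := by
  have hp' := (Real.HolderConjugate.conjExponent hp)
  have hq' := (Real.HolderConjugate.conjExponent hq)
  have ip : 1 / p + 1 / p.conjExponent = 1 := by simpa using hp'.inv_add_inv_eq_one
  have iq : 1 / q + 1 / q.conjExponent = 1 := by simpa using hq'.inv_add_inv_eq_one
  have hp0 := hp'.pos
  have hp0' := hp'.symm.pos
  have hq0 := hq'.pos
  have hq0' := hq'.symm.pos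
  set p' := p.conjExponent
  set q' := q.conjExponent
  set s := 1 / p + 1 / q' with hs
  have hs0 : 0 < s := by positivity
  have hmν : Measurable (bloomWeight p q w₁ w₂) := (hm₁.div hm₂).pow_const _
  set F : Fin 3 → X → ℝ≥0∞ := ![fun y => ENNReal.ofReal (bloomWeight p q w₁ w₂ y),
    fun y => ENNReal.ofReal (w₁ y ^ (-p')), fun y => ENNReal.ofReal (w₂ y ^ q)] with hF
  have key := ENNReal.lintegral_prod_norm_pow_le (μ := μ.restrict S) (f := F)
    (p := ![s / 2, 1 / p' / 2, 1 / q / 2]) Finset.univ ?_ ?_ ?_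
  · simp only [Fin.prod_univ_three, hF, Matrix.cons_val_zero, Matrix.cons_val_one,
      Matrix.cons_val] at key
    have e : ∀ y, ENNReal.ofReal (bloomWeight p q w₁ w₂ y) ^ (s / 2) *
        ENNReal.ofReal (w₁ y ^ (-p')) ^ (1 / p' / 2) * ENNReal.ofReal (w₂ y ^ q) ^ (1 / q / 2)
        = 1 := by
      intro y
      have a1 := h₁ y
      have a2 := h₂ y
      have a3 : 0 < bloomWeight p q w₁ w₂ y := Real.rpow_pos_of_pos (div_pos a1 a2) _
      rw [ENNReal.ofReal_rpow_of_pos a3, ENNReal.ofReal_rpow_of_pos (by positivity),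
        ENNReal.ofReal_rpow_of_pos (by positivity), ← ENNReal.ofReal_mul (by positivity),
        ← ENNReal.ofReal_mul (by positivity), ← ENNReal.ofReal_one]
      congr 1
      have b1 : bloomWeight p q w₁ w₂ y ^ (s / 2) = w₁ y ^ (1 / 2 : ℝ) / w₂ y ^ (1 / 2 : ℝ) := by
        rw [bloomWeight, ← Real.rpow_mul (div_pos a1 a2).le, ← Real.div_rpow a1.le a2.le]
        congr 1
        change 1 / s * (s / 2) = 1 / 2
        field_simp
      have b2 : (w₁ y ^ (-p')) ^ (1 / p' / 2) = (w₁ y ^ (1 / 2 : ℝ))⁻¹ := by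
        rw [← Real.rpow_mul a1.le, ← Real.rpow_neg a1.le]
        congr 1
        field_simp
      have b3 : (w₂ y ^ q) ^ (1 / q / 2) = w₂ y ^ (1 / 2 : ℝ) := by
        rw [← Real.rpow_mul a2.le]
        congr 1
        field_simp
      rw [b1, b2, b3]
      have : 0 < w₁ y ^ (1 / 2 : ℝ) := by positivity
      have : 0 < w₂ y ^ (1 / 2 : ℝ) := by positivity
      field_simp
    simp only [e, lintegral_const, Measure.restrict_apply MeasurableSet.univ, Set.univ_inter,
      one_mul] at key
    have sq : ∀ (a : ℝ≥0∞) (t : ℝ), (a ^ (t / 2)) ^ 2 = a ^ t := by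
      intro a t
      rw [← ENNReal.rpow_natCast, ← ENNReal.rpow_mul]
      congr 1
      push_cast
      ring
    calc μ S ^ 2 ≤ _ := pow_le_pow_left' key 2
      _ = _ := by
        rw [mul_pow, mul_pow, sq, sq, sq, mul_assoc]
        rfl
  · intro i _
    fin_cases i
    · exact hmν.ennreal_ofReal.aemeasurable
    · exact (hm₁.pow_const _).ennreal_ofReal.aemeasurable
    · exact (hm₂.pow_const _).ennreal_ofReal.aemeasurable
  · simp only [Fin.sum_univ_three, Matrix.cons_val_zero, Matrix.cons_val_one, Matrix.cons_val]
    linarith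
  · intro i _
    fin_cases i
    · exact (by positivity : 0 ≤ s / 2)
    · exact (by positivity : 0 ≤ 1 / p' / 2)
    · exact (by positivity : 0 ≤ 1 / q / 2)

/-- The λ₁ condition is used on the large ball, which contains both S' and B(x, r), and the λ₂
condition on B(x, r) itself. Multiplying the estimates and cancelling only μ(B(x, r)) avoids
dividing by weighted integrals. -/
theorem wmeas_rpow_mul_le_wmeas_bloomWeight [MeasurableSpace X] {d : X → X → ℝ} {μ : Measure X}
    (hpos : ∀ x, ∀ r > 0, μ (qball d x r) ≠ 0) (hfin : ∀ x, ∀ r > 0, μ (qball d x r) ≠ ∞)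
    {p q : ℝ} (hp : 1 < p) (hq : 1 < q) {w₁ w₂ : X → ℝ} (hm₁ : Measurable w₁)
    (hm₂ : Measurable w₂) (h₁ : ∀ x, 0 < w₁ x) (h₂ : ∀ x, 0 < w₂ x) {N₁ N₂ : ℝ≥0∞}
    (hN₁ : appConst d μ p w₁ ≤ N₁) (hN₂ : appConst d μ q w₂ ≤ N₂) {x z : X} {r R : ℝ}
    (hr : 0 < r) (hR : 0 < R) (hsub : qball d x r ⊆ qball d z R) {S' : Set X}
    (hS' : S' ⊆ qball d z R) :
    wmeas μ (fun y => w₁ y ^ p) S' ^ (1 / p) *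
        wmeas μ (fun y => w₂ y ^ (-q.conjExponent)) (qball d x r) ^ (1 / q.conjExponent) *
          μ (qball d x r) ≤
      N₁ * N₂ * μ (qball d z R) *
        wmeas μ (bloomWeight p q w₁ w₂) (qball d x r) ^ (1 / p + 1 / q.conjExponent) := by
  have hp0' := (Real.HolderConjugate.conjExponent hp).symm.pos
  have a1 := wmeas_rpow_mul_wmeas_rpow_le hp h₁ hN₁ z hR (hpos z R hR) (hfin z R hR)
  have a2 := wmeas_rpow_mul_wmeas_rpow_le hq h₂ hN₂ x hr (hpos x r hr) (hfin x r hr)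
  have a3 := measure_sq_le_wmeas_bloomWeight (μ := μ) hp hq hm₁ hm₂ h₁ h₂ (qball d x r)
  have a4 : wmeas μ (fun y => w₁ y ^ p) S' ^ (1 / p) *
      wmeas μ (fun y => w₁ y ^ (-p.conjExponent)) (qball d x r) ^ (1 / p.conjExponent) ≤
        N₁ * μ (qball d z R) := by
    refine le_trans ?_ a1
    gcongr
    · exact wmeas_mono μ _ hS'
    · exact wmeas_mono μ _ hsub
  generalize wmeas μ (fun y => w₁ y ^ p) S' ^ (1 / p) = a at *
  generalize wmeas μ (fun y => w₁ y ^ (-p.conjExponent)) (qball d x r) ^ (1 / p.conjExponent) = a'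
    at *
  generalize wmeas μ (fun y => w₂ y ^ (-q.conjExponent)) (qball d x r) ^ (1 / q.conjExponent) = e
    at *
  generalize wmeas μ (fun y => w₂ y ^ q) (qball d x r) ^ (1 / q) = g at *
  generalize wmeas μ (bloomWeight p q w₁ w₂) (qball d x r) ^ (1 / p + 1 / q.conjExponent) = V at *
  refine (ENNReal.mul_le_mul_iff_right (hpos x r hr) (hfin x r hr)).1 ?_
  calc μ (qball d x r) * (a * e * μ (qball d x r)) = μ (qball d x r) ^ 2 * (a * e) := by ring
    _ ≤ V * (a' * g) * (a * e) := by gcongr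
    _ = V * (a * a') * (g * e) := by ring
    _ ≤ V * (N₁ * μ (qball d z R)) * (N₂ * μ (qball d x r)) := by gcongr
    _ = _ := by ring

/-- Hölder's inequality for the weighted norm. -/
theorem setLIntegral_le_wnorm_mul [MeasurableSpace X] {μ : Measure X} {q : ℝ} (hq : 1 < q)
    {w : X → ℝ} (hm : Measurable w) (hw : ∀ x, 0 < w x) {S : Set X} {G : X → ℝ≥0∞}
    (hG : Measurable G) {u : X → ℂ} (hGu : ∀ᵐ x ∂μ.restrict S, G x ≤ ‖u x‖ₑ) :
    ∫⁻ x in S, G x ∂μ ≤ wnorm μ q w u *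
      wmeas μ (fun y => w y ^ (-q.conjExponent)) S ^ (1 / q.conjExponent) := by
  have hq' := Real.HolderConjugate.conjExponent hq
  have hq0 := hq'.pos
  set W : X → ℝ≥0∞ := fun x => ENNReal.ofReal (w x) with hW
  have hWm : Measurable W := hm.ennreal_ofReal
  have e : ∀ x, G x = ((fun x => G x * W x) * fun x => (W x)⁻¹) x := fun x => by
    simp only [Pi.mul_apply]
    rw [mul_assoc, ENNReal.mul_inv_cancel, mul_one]
    · simpa [hW] using hw x
    · exact ENNReal.ofReal_ne_top
  rw [lintegral_congr e]
  refine (ENNReal.lintegral_mul_le_Lp_mul_Lq _ hq' (hG.mul hWm).aemeasurable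
    hWm.inv.aemeasurable).trans ?_
  gcongr ?_ * ?_
  · rw [wnorm, eLpNorm_eq_lintegral_rpow_enorm_toReal (by simpa using hq0) ENNReal.ofReal_ne_top,
      ENNReal.toReal_ofReal hq0.le]
    gcongr ?_ ^ _
    refine le_trans (lintegral_mono_ae ?_) (setLIntegral_le_lintegral S _)
    filter_upwards [hGu] with x hx
    rw [enorm_mul, ← ofReal_norm (w x : ℂ), Complex.norm_real, Real.norm_of_nonneg (hw x).le]
    exact ENNReal.rpow_le_rpow (mul_le_mul' hx le_rfl) hq0.le
  · refine le_of_eq ?_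
    congr 1
    unfold wmeas
    congr 1 with x
    change (ENNReal.ofReal (w x))⁻¹ ^ _ = ENNReal.ofReal (w x ^ _)
    rw [Real.rpow_neg (hw x).le, ENNReal.ofReal_inv_of_pos (Real.rpow_pos_of_pos (hw x) _),
      ← ENNReal.ofReal_rpow_of_pos (hw x), ENNReal.inv_rpow]

theorem wnorm_le_wmeas_rpow [MeasurableSpace X] {μ : Measure X} {p : ℝ} (hp : 0 < p) {w : X → ℝ}
    (hw : ∀ x, 0 < w x) {S : Set X} (hS : MeasurableSet S) {f : X → ℂ} (hf : ∀ x, ‖f x‖ ≤ 1)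
    (hf0 : ∀ x ∉ S, f x = 0) : wnorm μ p w f ≤ wmeas μ (fun y => w y ^ p) S ^ (1 / p) := by
  rw [wnorm, eLpNorm_eq_lintegral_rpow_enorm_toReal (by simpa using hp) ENNReal.ofReal_ne_top,
    ENNReal.toReal_ofReal hp.le, wmeas, ← lintegral_indicator hS]
  gcongr with x
  by_cases hx : x ∈ S
  · rw [Set.indicator_of_mem hx, ← ENNReal.ofReal_rpow_of_pos (hw x), enorm_mul,
      ← ofReal_norm (w x : ℂ), Complex.norm_real, Real.norm_of_nonneg (hw x).le]
    gcongr
    refine mul_le_of_le_one_left zero_le ?_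
    rw [← ofReal_norm]
    exact ENNReal.ofReal_le_one.2 (hf x)
  · simp [hf0 x hx, hp]

/-! ### The lower bound for the commutator -/

section LowerBound

variable [TopologicalSpace X] [MeasurableSpace X] [BorelSpace X] {d : X → X → ℝ} {μ : Measure X}
  {A₀ A₁ cK : ℝ} {ω : ℝ → ℝ} {K : X → X → ℂ} {T : Lp ℂ 2 μ →L[ℂ] Lp ℂ 2 μ} {p q : ℝ}
  {w₁ w₂ : X → ℝ} {b : X → ℂ} {Θ : ℝ≥0}

/-- Testing the commutator on a function supported in a ball far away. -/
theorem lintegral_enorm_integral_sub_mul_le (h : IsHomogeneousType d μ A₀ A₁) (hω : IsModulus ω)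
    (hK : IsCZKernel d μ A₀ cK ω K) (hT : HasKernel T K) (hp : 1 < p) (hq : 1 < q)
    (h₁ : ∀ x, 0 < w₁ x) (hm₂ : Measurable w₂) (h₂ : ∀ x, 0 < w₂ x) (hb : MemL1loc d μ b)
    (hΘ : CommutatorBound d p q w₁ w₂ b T Θ) {A r : ℝ} (hA : 4 * A₀ ^ 2 ≤ A) (hr : 0 < r)
    {x₀ y₀ : X} (hxy : A * r ≤ d x₀ y₀) (hκ0 : K x₀ y₀ ≠ 0)
    (hκ : ∀ x ∈ qball d x₀ r, ∀ y ∈ qball d y₀ r, ‖K x y - K x₀ y₀‖ ≤ ‖K x₀ y₀‖ / 6)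
    {f : X → ℂ} (hf : Measurable f) (hf1 : ∀ y, ‖f y‖ ≤ 1) :
    ∫⁻ x in qball d x₀ r, ‖∫ y in qball d y₀ r, (b x - b y) * f y ∂μ‖ₑ ∂μ ≤
      ‖K x₀ y₀‖ₑ⁻¹ * (Θ * (wmeas μ (fun y => w₁ y ^ p) (qball d y₀ r) ^ (1 / p) *
        wmeas μ (fun y => w₂ y ^ (-q.conjExponent)) (qball d x₀ r) ^ (1 / q.conjExponent))) +
      6⁻¹ * ∫⁻ x in qball d x₀ r, ∫⁻ y in qball d y₀ r, ‖b x - b y‖ₑ ∂μ ∂μ := by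
  obtain ⟨hbm, hbi⟩ := hb
  have h0 : 0 < A₀ := lt_of_lt_of_le one_pos h.one_le_quasi
  set S := qball d x₀ r
  set S' := qball d y₀ r
  set κ := K x₀ y₀
  have hS : MeasurableSet S := h.measurableSet_ball x₀ r
  have hS' : MeasurableSet S' := h.measurableSet_ball y₀ r
  have hμ' : μ S' ≠ ∞ := (h.ball_lt_top y₀ r hr).ne
  have : IsFiniteMeasure (μ.restrict S') := isFiniteMeasure_restrict.2 hμ'
  have hbS' : IntegrableOn b S' μ := hbi y₀ r hr
  have hκe : ‖κ‖ₑ ≠ 0 := by simpa using hκ0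
  have hmem : ∀ x ∈ S, ∀ y ∈ S', r ≤ d x y := fun x hx y hy => (h.separated hA hr hxy hx hy).2
  have hsep : ∀ x ∈ S, x ∉ closure S' := fun x hx => h.notMem_closure hr (hmem x hx)
  have hKm : ∀ x ∈ S, AEStronglyMeasurable (K x) (μ.restrict S') := by
    intro x hx
    have hsub : S' ⊆ {x}ᶜ := by
      rintro y hy rfl
      exact hsep y hx (subset_closure hy)
    exact ((hK.continuousOn h hω x).mono hsub).aemeasurable hS' |>.aestronglyMeasurable
  have hKb : ∀ x ∈ S, ∀ y ∈ S', ‖K x y‖ ≤ 2 * ‖κ‖ := by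
    intro x hx y hy
    have h1 := norm_le_norm_add_norm_sub' (K x y) κ
    linarith [hκ x hx y hy, norm_nonneg κ]
  set g : X → ℂ := S'.indicator f with hg
  have hgm : Measurable g := hf.indicator hS'
  have hg1 : ∀ y, ‖g y‖ ≤ 1 := fun y => (norm_indicator_le_norm_self f y).trans (hf1 y)
  have hg0 : ∀ y ∉ S', g y = 0 := fun y hy => Set.indicator_of_notMem hy f
  have hgbs : MemLinftyBs d g := by
    refine ⟨hgm, ⟨1, hg1⟩, y₀, 2 * A₀ * r, by positivity, ?_⟩
    refine (closure_mono fun y hy => ?_).trans (h.closure_qball_subset y₀ hr)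
    by_contra hyS
    exact hy (hg0 y hyS)
  have hcomm := commutator_eq_integral hT hbm hgm hS' hμ' hbS' hg1 hg0 hsep hKm hKb
  have hfi : IntegrableOn f S' μ :=
    (integrable_const (1 : ℝ)).mono' hf.aestronglyMeasurable (.of_forall hf1)
  have hbf : IntegrableOn (fun y => b y * f y) S' μ :=
    hbS'.mul_bdd hf.aestronglyMeasurable (.of_forall hf1)
  have hdf : ∀ x, IntegrableOn (fun y => (b x - b y) * f y) S' μ := fun x =>
    ((integrable_const (b x)).sub hbS').mul_bdd hf.aestronglyMeasurable (.of_forall hf1)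
  set F : X → ℂ := fun x => ∫ y in S', (b x - b y) * f y ∂μ with hF
  have hFm : Measurable F := by
    have : F = fun x => b x * ∫ y in S', f y ∂μ - ∫ y in S', b y * f y ∂μ := by
      ext x
      simp only [hF, sub_mul]
      rw [integral_sub (hfi.const_mul _) hbf, integral_const_mul]
    rw [this]
    fun_prop
  set E : X → ℝ≥0∞ := fun x => ∫⁻ y in S', ‖b x - b y‖ₑ ∂μ with hE
  have hEm : Measurable E := by
    refine Measurable.lintegral_prod_right' (f := fun z : X × X => ‖b z.1 - b z.2‖ₑ) ?_
    fun_prop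
  -- A measurable minorant of the commutator, with truncated subtraction; Hölder is applied to G, so
  -- no measurability of the commutator is needed.
  set G : X → ℝ≥0∞ := fun x => ‖κ‖ₑ * (‖F x‖ₑ - 6⁻¹ * E x) with hG
  have hGm : Measurable G := (hFm.enorm.sub (hEm.const_mul _)).const_mul _
  have hGle : ∀ᵐ x ∂μ.restrict S, G x ≤ ‖commutator b T g x‖ₑ := by
    rw [ae_restrict_iff' hS]
    filter_upwards [hcomm] with x hx hxS
    have hKint : IntegrableOn (fun y => K x y * ((b x - b y) * f y)) S' μ :=
      (hdf x).bdd_mul (hKm x hxS) ((ae_restrict_iff' hS').2 (.of_forall (hKb x hxS)))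
    have e1 : commutator b T g x = ∫ y in S', K x y * ((b x - b y) * f y) ∂μ := by
      rw [hx hxS]
      refine setIntegral_congr_fun hS' fun y hy => ?_
      simp only [hg, Set.indicator_of_mem hy]
    -- Freezing the kernel at κ: the remainder has kernel K(x, y) - κ, of size at most |κ|/6.
    have e2 : κ * F x = commutator b T g x - ∫ y in S', (K x y - κ) * ((b x - b y) * f y) ∂μ := by
      rw [e1, hF, ← integral_const_mul]
      simp only [sub_mul (K x _) κ]
      rw [integral_sub hKint ((hdf x).const_mul _)]
      ring
    have e3 : ‖∫ y in S', (K x y - κ) * ((b x - b y) * f y) ∂μ‖ₑ ≤ ‖κ‖ₑ * (6⁻¹ * E x) := by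
      refine (enorm_integral_le_lintegral_enorm _).trans ?_
      rw [← mul_assoc, hE, ← lintegral_const_mul _ (by fun_prop)]
      refine setLIntegral_mono (by fun_prop) fun y hy => ?_
      rw [enorm_mul, enorm_mul]
      have f1 : ‖f y‖ₑ ≤ 1 := by
        rw [← ofReal_norm]
        exact ENNReal.ofReal_le_one.2 (hf1 y)
      have f2 : ‖K x y - κ‖ₑ ≤ ‖κ‖ₑ * 6⁻¹ := by
        rw [← ofReal_norm, ← ofReal_norm κ, ← div_eq_mul_inv]
        refine (ENNReal.ofReal_le_ofReal (hκ x hxS y hy)).trans (le_of_eq ?_)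
        rw [ENNReal.ofReal_div_of_pos (by norm_num)]
        norm_num
      exact mul_le_mul' f2 (mul_le_of_le_one_right zero_le f1)
    rw [hG]
    simp only
    rw [ENNReal.mul_sub (fun _ _ => enorm_ne_top), tsub_le_iff_right, ← enorm_mul, e2]
    exact enorm_sub_le.trans (by gcongr)
  have hGint : ‖κ‖ₑ * ∫⁻ x in S, (‖F x‖ₑ - 6⁻¹ * E x) ∂μ ≤
      Θ * (wmeas μ (fun y => w₁ y ^ p) S' ^ (1 / p) *
        wmeas μ (fun y => w₂ y ^ (-q.conjExponent)) S ^ (1 / q.conjExponent)) := by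
    rw [← lintegral_const_mul' _ _ enorm_ne_top, ← mul_assoc]
    refine (setLIntegral_le_wnorm_mul hq hm₂ h₂ hGm hGle).trans ?_
    gcongr
    refine (hΘ g hgbs).trans ?_
    gcongr
    exact wnorm_le_wmeas_rpow (by linarith) h₁ hS' hg1 hg0
  calc ∫⁻ x in S, ‖F x‖ₑ ∂μ ≤ ∫⁻ x in S, ((‖F x‖ₑ - 6⁻¹ * E x) + 6⁻¹ * E x) ∂μ :=
        lintegral_mono fun x => le_tsub_add
    _ = ∫⁻ x in S, (‖F x‖ₑ - 6⁻¹ * E x) ∂μ + 6⁻¹ * ∫⁻ x in S, E x ∂μ := by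
        rw [lintegral_add_right _ (hEm.const_mul _), lintegral_const_mul _ hEm]
    _ ≤ _ := by
        gcongr
        rw [mul_comm, ← div_eq_mul_inv, ENNReal.le_div_iff_mul_le (Or.inl hκe)
          (Or.inl enorm_ne_top), mul_comm]
        exact hGint

/-- The oscillation on a ball is controlled by the commutator bound. -/
theorem lintegral_sub_average_le_wmeas_bloomWeight (h : IsHomogeneousType d μ A₀ A₁)
    (hω : IsModulus ω) (hK : IsCZKernel d μ A₀ cK ω K) {c₀ Cbar : ℝ}
    (hnd : IsNondegenerate d μ c₀ Cbar K) (hT : HasKernel T K) (hp : 1 < p) (hq : 1 < q)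
    (hw₁ : IsWeight d μ w₁) (hw₂ : IsWeight d μ w₂) {N₁ N₂ : ℝ≥0}
    (hN₁ : appConst d μ p w₁ ≤ N₁) (hN₂ : appConst d μ q w₂ ≤ N₂) (hb : MemL1loc d μ b)
    (hΘ : CommutatorBound d p q w₁ w₂ b T Θ) {A : ℝ} {m n : ℕ} (hA : 4 * A₀ ^ 2 ≤ A)
    (hm : 2 * A₀ ^ 2 * (Cbar + 1) ≤ 2 ^ m)
    (hωA : 6 * c₀ * (1 + A₁ ^ m) * ω (2 * A₀ / A) ≤ 1)
    (hn : A₀ * (Cbar * A + A₀ * (Cbar + 1) * A) ≤ 2 ^ n) (x₀ : X) {r : ℝ} (hr : 0 < r) :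
    ∫⁻ x in qball d x₀ r, ‖b x - ⨍ z in qball d x₀ r, b z ∂μ‖ₑ ∂μ ≤
      4 * ENNReal.ofReal c₀ * (ENNReal.ofReal A₁ ^ n) ^ 2 * N₁ * N₂ * Θ *
        wmeas μ (bloomWeight p q w₁ w₂) (qball d x₀ r) ^ (1 / p + 1 / q.conjExponent) := by
  obtain ⟨hc₀, hC, hnd⟩ := hnd
  have h1 := h.one_le_quasi
  have h0 : 0 < A₀ := by linarith
  have hA1 : 1 ≤ A := by nlinarith
  have hAr : 0 < A * r := by positivity
  obtain ⟨y₀, ⟨hy1, hy2⟩, hy3⟩ := hnd x₀ (A * r) hAr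
  have hxy : A * r ≤ d x₀ y₀ := not_lt.1 hy2
  have hxy' : d x₀ y₀ < Cbar * (A * r) := hy1
  have hV : 0 < μ.real (qball d x₀ (A * r)) :=
    ENNReal.toReal_pos (h.measure_qball_pos _ hAr).ne' (h.ball_lt_top _ _ hAr).ne
  have hκpos : 0 < ‖K x₀ y₀‖ := lt_of_lt_of_le (by positivity) hy3
  have hκ : ∀ x ∈ qball d x₀ r, ∀ y ∈ qball d y₀ r, ‖K x y - K x₀ y₀‖ ≤ ‖K x₀ y₀‖ / 6 := by
    intro x hx y hy
    refine (hK.norm_sub_le h hω hA hr hm hxy hxy' hx hy).trans ?_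
    have h2 : (1 + A₁ ^ m) * ω (2 * A₀ / A) ≤ 1 / (6 * c₀) := by
      rw [le_div_iff₀ (by positivity)]
      linarith
    calc (1 + A₁ ^ m) * ω (2 * A₀ / A) / μ.real (qball d x₀ (A * r))
        ≤ 1 / (6 * c₀) / μ.real (qball d x₀ (A * r)) := by gcongr
      _ = 1 / (c₀ * μ.real (qball d x₀ (A * r))) / 6 := by field_simp
      _ ≤ _ := by gcongr
  -- The ball B(y₀, R) contains B(x₀, Ar) and both balls of radius r. In turn n doublings of either
  -- small ball cover it, which produces the two factors A₁ⁿ.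
  set R := A₀ * (Cbar + 1) * A * r with hRdef
  have hR : 0 < R := by positivity
  have hdR : A₀ * (d y₀ x₀ + A * r) ≤ R := by
    rw [h.dist_symm y₀ x₀]
    calc A₀ * (d x₀ y₀ + A * r) ≤ A₀ * (Cbar * (A * r) + A * r) := by gcongr
      _ = R := by rw [hRdef]; ring
  have hbig : qball d x₀ (A * r) ⊆ qball d y₀ R := h.qball_subset_qball hdR
  have hrAr : r ≤ A * r := le_mul_of_one_le_left hr.le hA1
  have hsub : qball d x₀ r ⊆ qball d y₀ R := (qball_mono d x₀ hrAr).trans hbig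
  have hsub' : qball d y₀ r ⊆ qball d y₀ R := by
    refine qball_mono d y₀ ?_
    have : 1 ≤ A₀ * (Cbar + 1) * A :=
      one_le_mul_of_one_le_of_one_le (one_le_mul_of_one_le_of_one_le h1 (by linarith)) hA1
    exact le_mul_of_one_le_left hr.le this
  have hRn : A₀ * (d x₀ y₀ + R) ≤ 2 ^ n * r := by
    calc A₀ * (d x₀ y₀ + R) ≤ A₀ * (Cbar * (A * r) + R) := by gcongr
      _ = A₀ * (Cbar * A + A₀ * (Cbar + 1) * A) * r := by rw [hRdef]; ring
      _ ≤ 2 ^ n * r := by gcongr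
  have hM : μ (qball d y₀ R) ≤ ENNReal.ofReal A₁ ^ n * μ (qball d x₀ r) :=
    (measure_mono (h.qball_subset_qball le_rfl)).trans (h.measure_qball_le x₀ hr hRn)
  have hM' : μ (qball d y₀ R) ≤ ENNReal.ofReal A₁ ^ n * μ (qball d y₀ r) := by
    refine h.measure_qball_le y₀ hr (le_trans ?_ hRn)
    calc R ≤ A₀ * R := le_mul_of_one_le_left hR.le h1
      _ ≤ A₀ * (d x₀ y₀ + R) := by
        have := h.dist_nonneg x₀ y₀
        gcongr
        linarith
  have hκinv : ‖K x₀ y₀‖ₑ⁻¹ ≤ ENNReal.ofReal c₀ * μ (qball d y₀ R) := by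
    have h2 : ‖K x₀ y₀‖⁻¹ ≤ c₀ * μ.real (qball d x₀ (A * r)) := by
      rw [one_div] at hy3
      exact inv_le_of_inv_le₀ (by positivity) hy3
    rw [← ofReal_norm, ← ENNReal.ofReal_inv_of_pos hκpos]
    refine (ENNReal.ofReal_le_ofReal h2).trans ?_
    rw [ENNReal.ofReal_mul hc₀.le, ofReal_measureReal (h.ball_lt_top _ _ hAr).ne]
    gcongr
  have hpos : ∀ x, ∀ r > 0, μ (qball d x r) ≠ 0 := fun x r hr => (h.measure_qball_pos x hr).ne'
  have hfin : ∀ x, ∀ r > 0, μ (qball d x r) ≠ ∞ := fun x r hr => (h.ball_lt_top x r hr).ne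
  refine (lintegral_sub_average_le hb.1 (hpos x₀ r hr) (hpos y₀ r hr) (hfin x₀ r hr)
    (hfin y₀ r hr) (hb.2 x₀ r hr) (hb.2 y₀ r hr) fun f hf hf1 =>
      lintegral_enorm_integral_sub_mul_le h hω hK hT hp hq hw₁.2.1 hw₂.1 hw₂.2.1 hb hΘ hA hr hxy
        (norm_pos_iff.1 hκpos) hκ hf hf1).trans ?_
  have hW := wmeas_rpow_mul_le_wmeas_bloomWeight hpos hfin hp hq hw₁.1 hw₂.1 hw₁.2.1 hw₂.2.1
    hN₁ hN₂ hr hR hsub hsub'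
  generalize wmeas μ (fun y => w₁ y ^ p) (qball d y₀ r) ^ (1 / p) *
    wmeas μ (fun y => w₂ y ^ (-q.conjExponent)) (qball d x₀ r) ^ (1 / q.conjExponent) = W at *
  generalize wmeas μ (bloomWeight p q w₁ w₂) (qball d x₀ r) ^ (1 / p + 1 / q.conjExponent) = V at *
  generalize ENNReal.ofReal A₁ ^ n = M at *
  have hW' : W ≤ N₁ * N₂ * M * V := by
    refine (ENNReal.mul_le_mul_iff_left (hpos x₀ r hr) (hfin x₀ r hr)).1 (hW.trans ?_)
    calc N₁ * N₂ * μ (qball d y₀ R) * V ≤ N₁ * N₂ * (M * μ (qball d x₀ r)) * V := by gcongr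
      _ = _ := by ring
  rw [ENNReal.div_le_iff (hpos y₀ r hr) (hfin y₀ r hr)]
  calc 4 * (‖K x₀ y₀‖ₑ⁻¹ * (Θ * W))
      ≤ 4 * (ENNReal.ofReal c₀ * (M * μ (qball d y₀ r)) * (Θ * (N₁ * N₂ * M * V))) := by
        gcongr
        exact hκinv.trans (by gcongr)
    _ = _ := by ring

end LowerBound

theorem wmeas_pos [MeasurableSpace X] {μ : Measure X} {w : X → ℝ} (hw : Measurable w)
    (hpos : ∀ x, 0 < w x) {S : Set X} (hS : μ S ≠ 0) : wmeas μ w S ≠ 0 := by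
  rw [wmeas, Ne, lintegral_eq_zero_iff hw.ennreal_ofReal]
  intro h0
  refine hS (Measure.restrict_eq_zero.1 (ae_eq_bot.1 (eventually_false_iff_eq_bot.1 ?_)))
  filter_upwards [h0] with x hx
  exact absurd hx (by simpa using hpos x)

end

end FracBloom

/-! ### Choice of constants and passage to the BMO norm -/

open FracBloom in
theorem theorem2 (A₀ A₁ cK c₀ Cbar p q : ℝ) (N₁ N₂ : ℝ≥0) (ω : ℝ → ℝ)
    (hω : FracBloom.IsModulus ω) (hDini : FracBloom.IsDini ω) (hp : 1 < p) (hpq : p ≤ q) :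
    ∃ C : ℝ≥0, 0 < C ∧
      ∀ (X : Type*) [TopologicalSpace X] [MeasurableSpace X] [BorelSpace X]
        (d : X → X → ℝ) (μ : Measure X), FracBloom.IsHomogeneousType d μ A₀ A₁ →
      ∀ K : X → X → ℂ, FracBloom.IsCZKernel d μ A₀ cK ω K →
        FracBloom.IsNondegenerate d μ c₀ Cbar K →
      ∀ T : Lp ℂ 2 μ →L[ℂ] Lp ℂ 2 μ, FracBloom.HasKernel T K →
      ∀ w₁ w₂ : X → ℝ, FracBloom.IsApp d μ p w₁ → FracBloom.appConst d μ p w₁ ≤ N₁ →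
        FracBloom.IsApp d μ q w₂ → FracBloom.appConst d μ q w₂ ≤ N₂ →
      ∀ α : ℝ, α / FracBloom.upperDim d μ = 1 / p - 1 / q →
      ∀ b : X → ℂ, FracBloom.MemL1loc d μ b →
        (∃ Θ : ℝ≥0, FracBloom.CommutatorBound d p q w₁ w₂ b T Θ) →
        FracBloom.MemBMO d μ α (FracBloom.bloomWeight p q w₁ w₂) b ∧
          FracBloom.bmoNorm d μ α (FracBloom.bloomWeight p q w₁ w₂) b ≤
            C * FracBloom.commutatorNorm d p q w₁ w₂ b T := by
  have hq : 1 < q := hp.trans_le hpq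
  obtain ⟨m, hm⟩ := pow_unbounded_of_one_lt (2 * A₀ ^ 2 * (Cbar + 1)) one_lt_two
  -- Constants are fixed before the space and the kernel, hence before c₀ and A₁ are known to be
  -- positive; the absolute values keep the threshold positive.
  obtain ⟨η, hη, -, hηω⟩ := hω.exists_le
    (ε := (6 * |c₀| * (1 + |A₁| ^ m) + 1)⁻¹) (by positivity)
  -- The first entry separates the balls; the second forces 2A₀/A ≤ η.
  set A : ℝ := max (4 * A₀ ^ 2) (2 * A₀ / η)
  obtain ⟨n, hn⟩ := pow_unbounded_of_one_lt
    (A₀ * (Cbar * A + A₀ * (Cbar + 1) * A)) one_lt_two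
  -- The summand 1 ensures C > 0 even if another factor vanishes.
  set C : ℝ≥0 := 4 * c₀.toNNReal * (A₁.toNNReal ^ n) ^ 2 * N₁ * N₂ + 1 with hC
  refine ⟨C, by positivity, ?_⟩
  intro X _ _ _ d μ h K hK hnd T hT w₁ w₂ hw₁ hN₁ hw₂ hN₂ α hα b hb hex
  have h1 := h.one_le_quasi
  have h0 : 0 < A₀ := by linarith
  have hc₀ : 0 < c₀ := hnd.1
  have hA₁ : 0 < A₁ := one_pos.trans_le h.one_le_doubling
  have hωA : 6 * c₀ * (1 + A₁ ^ m) * ω (2 * A₀ / A) ≤ 1 := by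
    have hA0 : 0 < A := lt_of_lt_of_le (by positivity) (le_max_left _ _)
    have hle : 2 * A₀ / A ≤ η := by
      rw [div_le_iff₀ hA0, mul_comm η, ← div_le_iff₀ hη]
      exact le_max_right _ _
    have h2 := hηω _ (by positivity) hle
    rw [abs_of_pos hc₀, abs_of_pos hA₁] at h2
    calc 6 * c₀ * (1 + A₁ ^ m) * ω (2 * A₀ / A)
        ≤ 6 * c₀ * (1 + A₁ ^ m) * (6 * c₀ * (1 + A₁ ^ m) + 1)⁻¹ := by gcongr
      _ ≤ 1 := by
        rw [← div_eq_mul_inv, div_le_one (by positivity)]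
        linarith
  set ν := bloomWeight p q w₁ w₂ with hν
  have hνm : Measurable ν := (hw₁.1.1.div hw₂.1.1).pow_const _
  have hνpos : ∀ x, 0 < ν x := fun x =>
    Real.rpow_pos_of_pos (div_pos (hw₁.1.2.1 x) (hw₂.1.2.1 x)) _
  have hexp : 1 / p + 1 / q.conjExponent = (1 / p - 1 / q) + 1 := by
    have : q⁻¹ + q.conjExponent⁻¹ = 1 := (Real.HolderConjugate.conjExponent hq).inv_add_inv_eq_one
    simp only [one_div]
    linarith
  have hαnn : 0 ≤ 1 / p - 1 / q := sub_nonneg.2 (one_div_le_one_div_of_le (by linarith) hpq)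
  have main : ∀ Θ : ℝ≥0, CommutatorBound d p q w₁ w₂ b T Θ → bmoNorm d μ α ν b ≤ C * Θ := by
    intro Θ hΘ
    refine iSup_le fun x => iSup_le fun r => iSup_le fun hr => ?_
    have hosc := lintegral_sub_average_le_wmeas_bloomWeight h hω hK hnd hT hp hq hw₁.1 hw₂.1
      hN₁ hN₂ hb hΘ (le_max_left _ _) hm.le hωA hn.le x hr
    rw [hα]
    have hv0 : wmeas μ ν (qball d x r) ≠ 0 := wmeas_pos hνm hνpos (h.measure_qball_pos x hr).ne'
    rw [← hν, hexp, ENNReal.rpow_add_of_nonneg _ _ hαnn zero_le_one, ENNReal.rpow_one] at hosc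
    generalize wmeas μ ν (qball d x r) = v at *
    -- Finiteness of ν(B) is not needed: if ν(B) = ∞, the normalised oscillation is 0.
    rcases eq_or_ne v ∞ with rfl | hvt
    · simp
    have hva0 : v ^ (1 / p - 1 / q) ≠ 0 := (ENNReal.rpow_pos (pos_iff_ne_zero.2 hv0) hvt).ne'
    have hvat : v ^ (1 / p - 1 / q) ≠ ∞ := ENNReal.rpow_ne_top_of_nonneg hαnn hvt
    generalize v ^ (1 / p - 1 / q) = va at *
    have hCle : 4 * ENNReal.ofReal c₀ * (ENNReal.ofReal A₁ ^ n) ^ 2 * N₁ * N₂ ≤ (C : ℝ≥0∞) := by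
      rw [hC]
      push_cast
      exact le_self_add
    calc va⁻¹ * (v⁻¹ * ∫⁻ y in qball d x r, ‖b y - ⨍ z in qball d x r, b z ∂μ‖ₑ ∂μ)
        ≤ va⁻¹ * (v⁻¹ * (C * Θ * (va * v))) := by
          gcongr
          exact hosc.trans (by gcongr)
      _ = C * Θ * (va⁻¹ * va) * (v⁻¹ * v) := by ring
      _ = C * Θ := by
          rw [ENNReal.inv_mul_cancel hva0 hvat, ENNReal.inv_mul_cancel hv0 hvt, mul_one, mul_one]
  refine ⟨⟨hb, ?_⟩, ?_⟩
  · obtain ⟨Θ, hΘ⟩ := hex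
    exact (main Θ hΘ).trans_lt (ENNReal.mul_lt_top ENNReal.coe_lt_top ENNReal.coe_lt_top)
  · have hC0 : (C : ℝ≥0∞) ≠ 0 := by
      rw [ENNReal.coe_ne_zero]
      positivity
    rw [mul_comm, ← ENNReal.div_le_iff hC0 ENNReal.coe_ne_top]
    refine le_iInf fun Θ => le_iInf fun hΘ => ?_
    rw [ENNReal.div_le_iff hC0 ENNReal.coe_ne_top, mul_comm]
    exact main Θ hΘ
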